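/- **Setting.** Let $n\ge 1$, let $\tau=\frac1n\mathrm{Tr}$ be the normalized trace on $M_n(\mathbb C)$, and let $\le$ be the Löwner order. A *quantum Markov semigroup* on $M_n(\mathbb C)$ is a strongly continuous semigroup $(P_t)_{t\ge0}$ of unital completely positive maps; its generator $\mathcal L$ is given by $P_t=e^{-t\mathcal L}$, and $\Gamma(A,B)=\frac12(\mathcal L(A)^*B+A^*\mathcal L(B)-\mathcal L(A^*B))$. It is *GNS-symmetric* with respect to a positive definite $\sigma$ with $\tau(\sigma)=1$ if $\tau(P_t(A)B\sigma)=\tau(AP_t(B)\sigma)$ for all $A,B$ and $t\ge 0$. $P_t^\dagger$ is defined by $\tau(P_t(A)B)=\tau(AP_t^\dagger(B))$. A *first-order differential calculus* for such a semigroup is a quadruple $(F,(V_t),\mathcal J,\partial)$ consisting of a finite-dimensional $M_n(\mathbb C)$-bimodule $F$ with a sesquilinear map $(\cdot|\cdot):F\times F\to M_n(\mathbb C)$, conjugate-linear in the first variable, such that $(\xi|A\eta B)=(A^*\xi|\eta)B$, $(\xi|\xi)\ge0$, and $(\xi|\xi)=0$ iff $\xi=0$; a strongly continuous group $(V_t)_{t\in\mathbb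 R}$ of linear isometries of $F$ for the norm $\|(\xi|\xi)\|^{1/2}$; an anti-linear map $\mathcal J:F\to F$; and a linear map $\partial:M_n(\mathbb C)\to F$ with $\partial(AB)=A\partial(B)+\partial(A)B$, such that for all $A,B\in M_n(\mathbb C)$, $\xi,\eta\in F$, $t\in\mathbb R$: $V_t(A\xi B)=\sigma^{it}A\sigma^{-it}(V_t\xi)\sigma^{it}B\sigma^{-it}$; $\mathcal J(A\xi B)=\sigma^{1/2}B^*\sigma^{-1/2}(\mathcal J\xi)\sigma^{1/2}A^*\sigma^{-1/2}$; $\tau((\mathcal J\xi|\mathcal J\eta)\sigma)=\tau((\eta|\xi)\sigma)$; $\mathcal JV_t=V_t\mathcal J$; $\partial(\sigma^{it}A\sigma^{-it})=V_t\partial(A)$; $\partial(\sigma^{1/2}A^*\sigma^{-1/2})=\mathcal J\partial(A)$; $F=\mathrm{lin}\{\partial(A)B\}$; $\Gamma(A,B)=(\partial(A)|\partial(B))$. An *operator mean function* is a continuous $\Lambda:[0,\infty)^2\to[0,\infty)$ such that $\Lambda(s,t)=s\,h(t/s)$ for $s,t>0$ with some $h:(0,\infty)\to(0,\infty)$, $h(1)=1$,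 that is operator monotone (for positive definite matrices $A\ge B$ of any size, $h(A)\ge h(B)$). Let $z\mapsto V_z$ be the analytic extension of $(V_t)$ to $\mathbb C$. For positive definite $\rho$ put $V^\rho_z=\rho^{iz}\sigma^{-iz}V_z(\cdot)\sigma^{iz}\rho^{-iz}$ and, with $f(t)=\Lambda(1,t)$, $\|\xi\|_{\Lambda,\rho}^2=\tau[(\xi|f(V^\rho_{-i})\xi)\rho]$. The semigroup satisfies $\mathrm{GE}_\Lambda(K,\infty)$ if $$\|\partial(P_t(A))\|_{\Lambda,\rho}^2\le e^{-2Kt}\|\partial(A)\|_{\Lambda,P_t^\dagger(\rho)}^2$$ for all self-adjoint $A$, positive definite $\rho$ and $t\ge0$. It has *intertwining curvature bounded below by $K$* if there is a strongly continuous semigroup $(\vec P_t)_{t\ge0}$ of linear maps on $F$ that satisfies, for all $t\ge 0$, $s\in\mathbb R$ and $\xi\in F$, $\vec P_t\partial=\partial P_t$, $\mathcal J\vec P_t=\vec P_t\mathcal J$, $\vec P_tV_s=V_s\vec P_t$ and $(\vec P_t\xi|\vec P_t\xi)\le e^{-2Kt}P_t(\xi|\xi)$. **Theorem.** The depolarizing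 semigroup $P_t(A)=e^{-t}A+(1-e^{-t})\tau(A)\mathbf 1$ on $M_n(\mathbb C)$ is a quantum Markov semigroup that is GNS-symmetric with respect to $\sigma=\mathbf 1$ and has a first-order differential calculus. For every first-order differential calculus of it the following hold. 1. $\mathrm{GE}_\Lambda\left(\frac12+\frac1n,\infty\right)$ holds for every operator mean function $\Lambda$. 2. If $n\ge2$, then the largest $K\in\mathbb R$ for which the semigroup has intertwining curvature bounded below by $K$ is $\frac12+\frac1{n+1}$, which is strictly smaller than $\frac12+\frac1n$. 3. Let $n=2$ and let $\Lambda$ be the logarithmic mean, $\Lambda(s,t)=\frac{s-t}{\log s-\log t}$ (extended continuously to $[0,\infty)^2$), which is an operator mean function. Then for every $K\in\mathbb R$, $\mathrm{GE}_\Lambda(K,\infty)$ implies the modified logarithmic Sobolev inequality $$\alpha\,\tau(\rho\log\rho)\le\tau(\mathcal L(\rho)\log\rho)\qquad\text{for all positive definite }\rho\text{ with }\tau(\rho)=1$$ with $\alpha=2K$, and the largest $\alpha\in\mathbb R$ for which this inequality holds is $\alpha=2$, the value given by the estimate in 1, namely $2\left(\frac12+\frac12\right)$. -/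

import Mathlib

open scoped RightActions ComplexOrder

universe u

noncomputable section

namespace QMS

/-- The algebra `M_n(ℂ)`. -/
abbrev Mat (n : ℕ) : Type := Matrix (Fin n) (Fin n) ℂ

/-- The normalized trace. -/
def tau {n : ℕ} (A : Mat n) : ℂ := (n : ℂ)⁻¹ * A.trace

/-- The Löwner order: `A ≤ B` iff `B - A` is positive semidefinite. -/
def LoewnerLE {n : ℕ} (A B : Mat n) : Prop := (B - A).PosSemidef

/-- The operator norm of a matrix acting on Euclidean space. -/
def opNorm {n : ℕ} (A : Mat n) : ℝ := ‖Matrix.toEuclideanCLM (n := Fin n) (𝕜 := ℂ) A‖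

/-- The power `σ ^ z = exp (z log σ)` of a positive definite matrix, `z ∈ ℂ`. -/
def mpow {n : ℕ} (σ : Mat n) (z : ℂ) : Mat n := NormedSpace.exp (z • cfc Real.log σ)

/-! ### Operator means -/

/-- Operator monotonicity of a function on `(0,∞)`, tested on matrices of every size. -/
def IsOperatorMonotone (h : ℝ → ℝ) : Prop :=
  ∀ (m : ℕ) (A B : Mat m), A.PosDef → B.PosDef → LoewnerLE B A → LoewnerLE (cfc h B) (cfc h A)

/-- Operator mean functions `Λ : [0,∞) × [0,∞) → [0,∞)`; values of the total function `Λ` at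
negative arguments play no role. -/
structure IsOperatorMean (Λ : ℝ → ℝ → ℝ) : Prop where
  nonneg : ∀ s t : ℝ, 0 ≤ s → 0 ≤ t → 0 ≤ Λ s t
  continuousOn : ContinuousOn (fun p : ℝ × ℝ => Λ p.1 p.2) (Set.Ici 0 ×ˢ Set.Ici 0)
  exists_monotone : ∃ h : ℝ → ℝ, (∀ t, 0 < t → 0 < h t) ∧ IsOperatorMonotone h ∧ h 1 = 1 ∧
    ∀ s t : ℝ, 0 < s → 0 < t → Λ s t = s * h (t / s)

/-- The logarithmic mean, extended continuously to the boundary of the quadrant. -/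
def logMean (s t : ℝ) : ℝ :=
  if s = t then s
  else if s = 0 ∨ t = 0 then 0
  else (s - t) / (Real.log s - Real.log t)

/-! ### Quantum Markov semigroups -/

/-- Complete positivity of a linear map on `M_n(ℂ)`. -/
def IsCompletelyPositive {n : ℕ} (Φ : Mat n →ₗ[ℂ] Mat n) : Prop :=
  ∀ (m : ℕ) (A B : Fin m → Mat n),
    (∑ j, ∑ k, (B j).conjTranspose * Φ ((A j).conjTranspose * A k) * B k).PosSemidef

/-- Quantum Markov semigroups; only the times `t ≥ 0` are relevant. -/
structure IsQMS {n : ℕ} (P : ℝ → Mat n →ₗ[ℂ] Mat n) : Prop where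
  zero : P 0 = LinearMap.id
  add : ∀ s t : ℝ, 0 ≤ s → 0 ≤ t → P (s + t) = P s ∘ₗ P t
  unital : ∀ t : ℝ, 0 ≤ t → P t 1 = 1
  cp : ∀ t : ℝ, 0 ≤ t → IsCompletelyPositive (P t)
  continuous : ∀ A, Filter.Tendsto (fun t => P t A) (nhdsWithin 0 (Set.Ici 0)) (nhds A)

/-- `P` is a quantum Markov semigroup that is GNS-symmetric with respect to the
positive definite matrix `σ` with `τ(σ) = 1`. -/
structure IsGNSSymmetricQMS {n : ℕ} (σ : Mat n) (P : ℝ → Mat n →ₗ[ℂ] Mat n) : Prop where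
  qms : IsQMS P
  posDef : σ.PosDef
  tau_eq_one : tau σ = 1
  symm : ∀ t : ℝ, 0 ≤ t → ∀ A B, tau (P t A * B * σ) = tau (A * P t B * σ)

/-- The generator `L` of `P_t = exp (-t L)`, that is, `L(A) = - d/dt P_t(A)` at `t = 0`. -/
def generator {n : ℕ} (P : ℝ → Mat n →ₗ[ℂ] Mat n) (A : Mat n) : Mat n :=
  Matrix.of fun i j => -derivWithin (fun t : ℝ => P t A i j) (Set.Ici 0) 0

/-- The carré du champ `Γ(A,B) = (L(A)* B + A* L(B) - L(A* B)) / 2`. -/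
def carre {n : ℕ} (P : ℝ → Mat n →ₗ[ℂ] Mat n) (A B : Mat n) : Mat n :=
  (1 / 2 : ℂ) • ((generator P A).conjTranspose * B + A.conjTranspose * generator P B
    - generator P (A.conjTranspose * B))

/-- The adjoint `T†` of `T` with respect to `τ`; it is characterized by `tau_mul_dagger`. -/
def dagger {n : ℕ} (T : Mat n →ₗ[ℂ] Mat n) (B : Mat n) : Mat n :=
  Matrix.of fun i j => (T (Matrix.single j i 1) * B).trace

theorem tau_mul_dagger {n : ℕ} (T : Mat n →ₗ[ℂ] Mat n) (A B : Mat n) :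
    tau (T A * B) = tau (A * dagger T B) := by
  unfold tau
  congr 1
  conv_lhs => rw [Matrix.matrix_eq_sum_single A]
  simp only [map_sum, Finset.sum_mul, Matrix.trace_sum]
  rw [Matrix.trace]
  refine Finset.sum_congr rfl fun i _ => ?_
  rw [Matrix.diag_apply, Matrix.mul_apply]
  refine Finset.sum_congr rfl fun j _ => ?_
  have h : Matrix.single i j (A i j) = A i j • Matrix.single i j (1 : ℂ) := by
    rw [Matrix.smul_single, smul_eq_mul, mul_one]
  rw [h, map_smul, Matrix.smul_mul, Matrix.trace_smul, smul_eq_mul, dagger, Matrix.of_apply]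

/-! ### First-order differential calculus -/

/-- A first-order differential calculus `(F, (V_t), J, ∂)` for the semigroup `P` that is
GNS-symmetric with respect to `σ`. Here `F` is a finite-dimensional Hilbert `C*`-bimodule over
`M_n(ℂ)` with `M_n(ℂ)`-valued inner product `(ξ ∣ η)`, written `ip ξ η`, which is conjugate-linear
in `ξ` and linear in `η`; the norm of `ξ` is `‖(ξ ∣ ξ)‖ ^ (1/2)`. The left and right actions are
`A •> ξ` and `ξ <• B`. -/
structure FirstOrderCalculus {n : ℕ} (σ : Mat n) (P : ℝ → Mat n →ₗ[ℂ] Mat n) where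
  F : Type u
  [addCommGroup : AddCommGroup F]
  [moduleC : Module ℂ F]
  [finiteDimensional : FiniteDimensional ℂ F]
  [moduleLeft : Module (Mat n) F]
  [moduleRight : Module (Mat n)ᵐᵒᵖ F]
  [towerLeft : IsScalarTower ℂ (Mat n) F]
  [towerRight : IsScalarTower ℂ (Mat n)ᵐᵒᵖ F]
  [bimodule : SMulCommClass (Mat n) (Mat n)ᵐᵒᵖ F]
  ip : F →ₗ⋆[ℂ] F →ₗ[ℂ] Mat n
  ip_smul : ∀ (ξ η : F) (A B : Mat n),
    ip ξ ((A •> η) <• B) = ip (A.conjTranspose •> ξ) η * B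
  ip_nonneg : ∀ ξ : F, (ip ξ ξ).PosSemidef
  ip_self_eq_zero : ∀ ξ : F, ip ξ ξ = 0 ↔ ξ = 0
  V : ℝ → F →ₗ[ℂ] F
  V_zero : V 0 = LinearMap.id
  V_add : ∀ s t : ℝ, V (s + t) = V s ∘ₗ V t
  V_isometry : ∀ (t : ℝ) (ξ : F), opNorm (ip (V t ξ) (V t ξ)) = opNorm (ip ξ ξ)
  V_continuous : ∀ ξ : F,
    Filter.Tendsto (fun t => opNorm (ip (V t ξ - ξ) (V t ξ - ξ))) (nhds 0) (nhds 0)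
  J : F →ₗ⋆[ℂ] F
  d : Mat n →ₗ[ℂ] F
  leibniz : ∀ A B : Mat n, d (A * B) = A •> d B + d A <• B
  V_smul : ∀ (t : ℝ) (A B : Mat n) (ξ : F), V t ((A •> ξ) <• B) =
    ((mpow σ (Complex.I * t) * A * mpow σ (-(Complex.I * t))) •> V t ξ) <•
      (mpow σ (Complex.I * t) * B * mpow σ (-(Complex.I * t)))
  J_smul : ∀ (A B : Mat n) (ξ : F), J ((A •> ξ) <• B) =
    ((mpow σ (1 / 2) * B.conjTranspose * mpow σ (-(1 / 2))) •> J ξ) <•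
      (mpow σ (1 / 2) * A.conjTranspose * mpow σ (-(1 / 2)))
  J_ip : ∀ ξ η : F, tau (ip (J ξ) (J η) * σ) = tau (ip η ξ * σ)
  J_V : ∀ t : ℝ, ∀ ξ : F, J (V t ξ) = V t (J ξ)
  d_modular : ∀ (t : ℝ) (A : Mat n),
    d (mpow σ (Complex.I * t) * A * mpow σ (-(Complex.I * t))) = V t (d A)
  d_conj : ∀ A : Mat n, d (mpow σ (1 / 2) * A.conjTranspose * mpow σ (-(1 / 2))) = J (d A)
  span_eq_top : Submodule.span ℂ {ξ : F | ∃ A B : Mat n, ξ = d A <• B} = ⊤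
  carre_eq : ∀ A B : Mat n, carre P A B = ip (d A) (d B)

attribute [instance] FirstOrderCalculus.addCommGroup FirstOrderCalculus.moduleC
  FirstOrderCalculus.finiteDimensional FirstOrderCalculus.moduleLeft
  FirstOrderCalculus.moduleRight FirstOrderCalculus.towerLeft FirstOrderCalculus.towerRight
  FirstOrderCalculus.bimodule

open Classical in
/-- Functional calculus `f(T)` for a diagonalizable endomorphism `T` with real eigenvalues of a
finite-dimensional space: `f(T) = p(T)` for the polynomial `p` interpolating `f` on the spectrum.
It acts as `f(μ)` on the eigenspace of `μ`, see `funCalc_apply_eigenvector`. -/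
def funCalc {F : Type*} [AddCommGroup F] [Module ℂ F] (f : ℝ → ℝ) (T : F →ₗ[ℂ] F) : F →ₗ[ℂ] F :=
  Polynomial.aeval (R := ℂ) (A := Module.End ℂ F) T
    (Lagrange.interpolate (minpoly ℂ (T : Module.End ℂ F)).roots.toFinset id
      (fun z => (f z.re : ℂ)))

theorem funCalc_apply_eigenvector {F : Type*} [AddCommGroup F] [Module ℂ F]
    [FiniteDimensional ℂ F] (f : ℝ → ℝ) (T : F →ₗ[ℂ] F) (μ : ℝ) (ξ : F)
    (h : T ξ = (μ : ℂ) • ξ) : funCalc f T ξ = (f μ : ℂ) • ξ := by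
  classical
  by_cases hξ : ξ = 0
  · simp [hξ]
  have hv : Module.End.HasEigenvector T (μ : ℂ) ξ :=
    ⟨Module.End.mem_eigenspace_iff.mpr h, hξ⟩
  have hr : (μ : ℂ) ∈ (minpoly ℂ (T : Module.End ℂ F)).roots.toFinset := by
    rw [Multiset.mem_toFinset,
      Polynomial.mem_roots (minpoly.ne_zero (Algebra.IsIntegral.isIntegral _))]
    exact Module.End.isRoot_of_hasEigenvalue (Module.End.hasEigenvalue_of_hasEigenvector hv)
  unfold funCalc
  rw [Module.End.aeval_apply_of_hasEigenvector hv]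
  congr 1
  have := Lagrange.eval_interpolate_at_node (fun z : ℂ => (f z.re : ℂ)) (v := id)
    (Set.injOn_id _) hr
  simpa using this

namespace FirstOrderCalculus

variable {n : ℕ} {σ : Mat n} {P : ℝ → Mat n →ₗ[ℂ] Mat n}

/-- `W` is an analytic extension of `t ↦ V_t` to the complex plane. -/
def IsAnalyticExtension (C : FirstOrderCalculus.{u} σ P) (W : ℂ → C.F →ₗ[ℂ] C.F) : Prop :=
  (∀ t : ℝ, W t = C.V t) ∧
    ∀ (ξ : C.F) (φ : C.F →ₗ[ℂ] ℂ), Differentiable ℂ (fun z => φ (W z ξ))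

open Classical in
/-- The analytic extension `z ↦ V_z` (it exists and is unique, as `F` is finite-dimensional). -/
def Vext (C : FirstOrderCalculus.{u} σ P) : ℂ → C.F →ₗ[ℂ] C.F :=
  if h : ∃ W, C.IsAnalyticExtension W then h.choose else 0

/-- The two-sided multiplication `ξ ↦ A ξ B` on `F`. -/
def mulBoth (C : FirstOrderCalculus.{u} σ P) (A B : Mat n) : C.F →ₗ[ℂ] C.F where
  toFun ξ := (A •> ξ) <• B
  map_add' ξ η := by rw [smul_add, smul_add]
  map_smul' c ξ := by
    rw [smul_comm A c ξ, smul_comm (MulOpposite.op B) c (A •> ξ), RingHom.id_apply]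

/-- `V^ρ_z = ρ^{iz} σ^{-iz} V_z(·) σ^{iz} ρ^{-iz}`. -/
def Vrho (C : FirstOrderCalculus.{u} σ P) (ρ : Mat n) (z : ℂ) : C.F →ₗ[ℂ] C.F :=
  C.mulBoth (mpow ρ (Complex.I * z) * mpow σ (-(Complex.I * z)))
    (mpow σ (Complex.I * z) * mpow ρ (-(Complex.I * z))) ∘ₗ C.Vext z

/-- `⟨ξ, η⟩_{Λ,ρ} = τ((ξ ∣ f(V^ρ_{-i}) η) ρ)` with `f(t) = Λ(1,t)`. -/
def innerMean (C : FirstOrderCalculus.{u} σ P) (Λ : ℝ → ℝ → ℝ) (ρ : Mat n) (ξ η : C.F) : ℂ :=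
  tau (C.ip ξ (funCalc (fun t => Λ 1 t) (C.Vrho ρ (-Complex.I)) η) * ρ)

/-- The squared norm `‖ξ‖²_{Λ,ρ} = ⟨ξ, ξ⟩_{Λ,ρ}`. -/
def normSqMean (C : FirstOrderCalculus.{u} σ P) (Λ : ℝ → ℝ → ℝ) (ρ : Mat n) (ξ : C.F) : ℝ :=
  (C.innerMean Λ ρ ξ ξ).re

/-- The gradient estimate `GE_Λ(K,∞)`. -/
def GradientEstimate (C : FirstOrderCalculus.{u} σ P) (Λ : ℝ → ℝ → ℝ) (K : ℝ) : Prop :=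
  ∀ A ρ : Mat n, A.IsHermitian → ρ.PosDef → ∀ t : ℝ, 0 ≤ t →
    C.normSqMean Λ ρ (C.d (P t A)) ≤
      Real.exp (-2 * K * t) * C.normSqMean Λ (dagger (P t) ρ) (C.d A)

/-- Intertwining curvature bounded below by `K`. -/
def IntertwiningCurvatureGE (C : FirstOrderCalculus.{u} σ P) (K : ℝ) : Prop :=
  ∃ Q : ℝ → C.F →ₗ[ℂ] C.F,
    Q 0 = LinearMap.id ∧
    (∀ s t : ℝ, 0 ≤ s → 0 ≤ t → Q (s + t) = Q s ∘ₗ Q t) ∧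
    (∀ ξ : C.F, Filter.Tendsto (fun t => opNorm (C.ip (Q t ξ - ξ) (Q t ξ - ξ)))
      (nhdsWithin 0 (Set.Ici 0)) (nhds 0)) ∧
    (∀ t : ℝ, 0 ≤ t → ∀ A : Mat n, Q t (C.d A) = C.d (P t A)) ∧
    (∀ t : ℝ, 0 ≤ t → ∀ ξ : C.F, C.J (Q t ξ) = Q t (C.J ξ)) ∧
    (∀ s t : ℝ, 0 ≤ t → ∀ ξ : C.F, Q t (C.V s ξ) = C.V s (Q t ξ)) ∧
    (∀ t : ℝ, 0 ≤ t → ∀ ξ : C.F,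
      LoewnerLE (C.ip (Q t ξ) (Q t ξ)) ((Real.exp (-2 * K * t) : ℂ) • P t (C.ip ξ ξ)))

end FirstOrderCalculus

/-- The modified logarithmic Sobolev inequality `α τ(ρ log ρ) ≤ τ(L(ρ) log ρ)` for all positive
definite `ρ` with `τ(ρ) = 1`. (For singular `ρ` the right side is read as its limit.) -/
def HasMLSI {n : ℕ} (P : ℝ → Mat n →ₗ[ℂ] Mat n) (α : ℝ) : Prop :=
  ∀ ρ : Mat n, ρ.PosDef → tau ρ = 1 →
    α * (tau (ρ * cfc Real.log ρ)).re ≤ (tau (generator P ρ * cfc Real.log ρ)).re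

/-- The depolarizing semigroup `P_t(A) = e^{-t} A + (1 - e^{-t}) τ(A) 1`. -/
def depolarizing (n : ℕ) (t : ℝ) : Mat n →ₗ[ℂ] Mat n where
  toFun A := (Real.exp (-t) : ℂ) • A + ((1 - Real.exp (-t) : ℂ) * tau A) • (1 : Mat n)
  map_add' A B := by
    simp only [tau, Matrix.trace_add, smul_add, mul_add, add_smul]
    abel
  map_smul' c A := by
    simp only [tau, Matrix.trace_smul, smul_add, smul_smul, smul_eq_mul, RingHom.id_apply]
    congr 2 <;> ring

end QMS

end

open QMS

noncomputable section

namespace QMS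

/-! ### The depolarizing semigroup -/

/-! For `σ = 1` the modular group `V` is the identity and `d` kills scalars, so `d (P_t A) = e^{-t}
d A`. The carré du champ is `Γ(A,B) = ½(A*B − conj(τ A) B − τ(B) A* + τ(A*B))`, and the mean norms
of the vectors `d A` depend only on it, not on the calculus. One calculus is given by commutators
acting on matrices.

Gradient estimate. In an eigenbasis of `ρ`, the operator `ξ ↦ ρ ξ ρ⁻¹` is diagonal on the blocks
`p_k ξ p_m`, and the norm becomes `∑ Λ(l_m, l_k) w_km`, where `w_km` is an explicit quadratic
expression in the entries of `A` (`normSqMean_conjDiag`, `tau_ip_colProj_smul_d`). The semigroup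
replaces each `l_i` by `e^{-t} l_i + (1 - e^{-t}) m`, with `m` the mean eigenvalue. An operator
monotone function is concave, so `Λ` is jointly superadditive along this mixing and `Λ(s,r) + Λ(r,s)
≤ s + r`. For two distinct eigenvalues `s + r ≤ n m`, and convexity of `exp` turns this into a gain
of rate `2/n` (`exp_mul_add_swap_le`). Positivity is available only for symmetrized pairs, and not
for single diagonal coefficients; `sum_weight_nonneg` rearranges the quadratic form so that pairs
suffice.

Intertwining curvature. On the range of `d` the semigroup `Q_t` is forced to be `e^{-t}`. On the
orthogonal complement one may damp further, by `e^{-κt}`, with `κ = 2/(n+1)` the best constant in `κ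
Γ(A,A) ≤ τ(Γ(A,A))`. This rate makes the cross terms between the two parts cancel
(`vecSemigroup_estimate`). A matrix unit off the diagonal attains the constant, and differentiating
the estimate for it at `t = 0` gives optimality.

Logarithmic Sobolev inequality. For `n = 2` a normalized density has eigenvalues `1 ± x`, and the
inequality with constant `2` is a termwise comparison of power series; small `x` shows sharpness.
Testing a gradient estimate at `ρ = 1` gives `K ≤ 1`, so the inequality with constant `2K` follows
from the one with constant `2`, since entropy is nonnegative. -/

theorem tau_add {n : ℕ} (A B : Mat n) : tau (A + B) = tau A + tau B := by
  simp [tau, Matrix.trace_add, mul_add]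

theorem tau_sub {n : ℕ} (A B : Mat n) : tau (A - B) = tau A - tau B := by
  simp [tau, Matrix.trace_sub, mul_sub]

theorem tau_smul {n : ℕ} (c : ℂ) (A : Mat n) : tau (c • A) = c * tau A := by
  simp only [tau, Matrix.trace_smul, smul_eq_mul]; ring

theorem tau_mul_comm {n : ℕ} (A B : Mat n) : tau (A * B) = tau (B * A) := by
  rw [tau, Matrix.trace_mul_comm, tau]

theorem tau_conjTranspose {n : ℕ} (A : Mat n) : tau A.conjTranspose = star (tau A) := by
  simp [tau, Matrix.trace_conjTranspose]

theorem tau_one {n : ℕ} (hn : 1 ≤ n) : tau (1 : Mat n) = 1 := by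
  have : (n : ℂ) ≠ 0 := by exact_mod_cast (by omega : n ≠ 0)
  simp [tau, this]

theorem tau_sum {n : ℕ} {ι : Type*} (s : Finset ι) (f : ι → Mat n) :
    tau (∑ i ∈ s, f i) = ∑ i ∈ s, tau (f i) := by
  simp [tau, Matrix.trace_sum, Finset.mul_sum]

theorem depolarizing_apply (n : ℕ) (t : ℝ) (A : Mat n) :
    depolarizing n t A =
      (Real.exp (-t) : ℂ) • A + ((1 - Real.exp (-t) : ℂ) * tau A) • (1 : Mat n) := rfl

theorem tau_depolarizing {n : ℕ} (hn : 1 ≤ n) (t : ℝ) (A : Mat n) :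
    tau (depolarizing n t A) = tau A := by
  rw [depolarizing_apply, tau_add, tau_smul, tau_smul, tau_one hn]; ring

theorem mpow_one_left {n : ℕ} (z : ℂ) : mpow (1 : Mat n) z = 1 := by
  have h : cfc Real.log (1 : Mat n) = 0 := by
    have h1 : (1 : Mat n) = algebraMap ℝ (Mat n) 1 := by simp
    rw [h1, cfc_algebraMap]; simp
  simp [mpow, h, NormedSpace.exp_zero]

theorem generator_depolarizing {n : ℕ} (A : Mat n) :
    generator (depolarizing n) A = A - tau A • (1 : Mat n) := by
  ext i j
  rw [generator, Matrix.of_apply]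
  have h0 : HasDerivAt (fun t : ℝ => (Real.exp (-t) : ℂ)) (-1) 0 := by
    have h : HasDerivAt (fun t : ℝ => Real.exp (-t)) (-1) 0 := by
      simpa using (hasDerivAt_neg (0 : ℝ)).exp
    simpa using h.ofReal_comp
  have h1 : HasDerivAt (fun t : ℝ => depolarizing n t A i j)
      (-1 * A i j + (-(-1) * tau A) * (1 : Mat n) i j) 0 := by
    have := (h0.mul_const (A i j)).add (((h0.const_sub 1).mul_const (tau A)).mul_const
      ((1 : Mat n) i j))
    exact this
  rw [h1.hasDerivWithinAt.derivWithin (uniqueDiffWithinAt_Ici 0)]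
  simp
  ring

theorem carre_depolarizing {n : ℕ} (A B : Mat n) : carre (depolarizing n) A B =
    (1 / 2 : ℂ) • (A.conjTranspose * B - star (tau A) • B - tau B • A.conjTranspose
      + tau (A.conjTranspose * B) • (1 : Mat n)) := by
  rw [carre, generator_depolarizing, generator_depolarizing, generator_depolarizing]
  congr 1
  rw [Matrix.conjTranspose_sub, Matrix.conjTranspose_smul, Matrix.conjTranspose_one, sub_mul,
    mul_sub, Matrix.smul_mul, Matrix.mul_smul, one_mul, mul_one]
  abel

theorem tau_mul_single {n : ℕ} (A : Mat n) (i j : Fin n) :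
    tau (Matrix.single j i 1 * A) = (n : ℂ)⁻¹ * A i j := by
  rw [tau, Matrix.trace_single_mul, one_smul]

theorem dagger_depolarizing {n : ℕ} (t : ℝ) (A : Mat n) :
    dagger (depolarizing n t) A = depolarizing n t A := by
  ext i j
  rw [dagger, Matrix.of_apply, depolarizing_apply, depolarizing_apply, add_mul, Matrix.trace_add,
    Matrix.smul_mul, Matrix.smul_mul, Matrix.trace_smul, Matrix.trace_smul, one_mul,
    Matrix.trace_single_mul]
  rw [Matrix.add_apply, Matrix.smul_apply, Matrix.smul_apply]
  congr 1
  · simp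
  · simp only [tau, smul_eq_mul]
    by_cases h : i = j
    · subst h; simp; ring
    · rw [Matrix.one_apply_ne h, Matrix.trace_single_eq_of_ne _ _ _ (Ne.symm h)]; simp

theorem tau_conjTranspose_mul {n : ℕ} (A B : Mat n) :
    tau (A.conjTranspose * B) = (n : ℂ)⁻¹ * ∑ i, ∑ j, star (A i j) * B i j := by
  rw [tau, Matrix.trace, Finset.sum_comm]
  simp [Matrix.mul_apply, Matrix.conjTranspose_apply]

/-- The identity part contributes one term `X* X`. Expanding `τ(A_j* A_k)` entrywise, the trace part
contributes `n⁻¹ ∑ Y_ab* Y_ab` with `Y_ab = ∑_j (A_j)_ab B_j`. -/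
theorem isCompletelyPositive_depolarizing {n : ℕ} {t : ℝ} (ht : 0 ≤ t) :
    IsCompletelyPositive (depolarizing n t) := by
  intro m A B
  have h : ∑ j, ∑ k, (B j).conjTranspose * depolarizing n t ((A j).conjTranspose * A k) * B k =
      (Real.exp (-t) : ℝ) • ((∑ j, A j * B j).conjTranspose * ∑ j, A j * B j) +
        ((1 - Real.exp (-t)) * (n : ℝ)⁻¹ : ℝ) • ∑ a, ∑ b, (∑ j, A j a b • B j).conjTranspose *
          ∑ j, A j a b • B j := by
    have e1 : (∑ j, A j * B j).conjTranspose * ∑ j, A j * B j =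
        ∑ j, ∑ k, (B j).conjTranspose * ((A j).conjTranspose * A k) * B k := by
      rw [Matrix.conjTranspose_sum, Finset.sum_mul_sum]
      simp only [Matrix.conjTranspose_mul, Matrix.mul_assoc]
    have e2 : ∑ a, ∑ b, (∑ j, A j a b • B j).conjTranspose * ∑ j, A j a b • B j =
        ∑ j, ∑ k, (∑ a, ∑ b, star (A j a b) * A k a b) • ((B j).conjTranspose * B k) := by
      simp only [Matrix.conjTranspose_sum, Finset.sum_mul_sum, Finset.sum_smul]
      calc _ = ∑ a, ∑ j, ∑ b, ∑ k, (A j a b • B j).conjTranspose * (A k a b • B k) :=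
            Finset.sum_congr rfl fun a _ => Finset.sum_comm
        _ = ∑ j, ∑ a, ∑ k, ∑ b, (A j a b • B j).conjTranspose * (A k a b • B k) := by
            rw [Finset.sum_comm]
            exact Finset.sum_congr rfl fun j _ => Finset.sum_congr rfl fun a _ => Finset.sum_comm
        _ = _ := by
            refine Finset.sum_congr rfl fun j _ => ?_
            rw [Finset.sum_comm]
            refine Finset.sum_congr rfl fun k _ => Finset.sum_congr rfl fun a _ =>
              Finset.sum_congr rfl fun b _ => ?_
            rw [Matrix.conjTranspose_smul, Matrix.smul_mul, Matrix.mul_smul, smul_smul]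
    rw [e1, e2, Finset.smul_sum, Finset.smul_sum, ← Finset.sum_add_distrib]
    refine Finset.sum_congr rfl fun j _ => ?_
    rw [Finset.smul_sum, Finset.smul_sum, ← Finset.sum_add_distrib]
    refine Finset.sum_congr rfl fun k _ => ?_
    rw [depolarizing_apply, tau_conjTranspose_mul, mul_add, add_mul, Matrix.mul_smul,
      Matrix.smul_mul, Matrix.mul_smul, Matrix.smul_mul, mul_one]
    congr 1
    rw [← Complex.coe_smul, smul_smul]
    push_cast
    rw [mul_assoc]
  rw [h]
  refine Matrix.PosSemidef.add ?_ ?_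
  · exact (Matrix.posSemidef_conjTranspose_mul_self _).smul (Real.exp_pos _).le
  · refine Matrix.PosSemidef.smul ?_ ?_
    · exact Matrix.posSemidef_sum _ fun a _ => Matrix.posSemidef_sum _ fun b _ =>
        Matrix.posSemidef_conjTranspose_mul_self _
    · have : Real.exp (-t) ≤ 1 := Real.exp_le_one_iff.mpr (by linarith)
      exact mul_nonneg (by linarith) (by positivity)

theorem isGNSSymmetricQMS_depolarizing {n : ℕ} (hn : 1 ≤ n) :
    IsGNSSymmetricQMS (1 : Mat n) (depolarizing n) where
  qms :=
    { zero := by ext1 A; simp [depolarizing_apply]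
      add := by
        intro s t _ _
        ext1 A
        rw [LinearMap.comp_apply, depolarizing_apply n s, tau_depolarizing hn, depolarizing_apply,
          depolarizing_apply, smul_add, smul_smul, smul_smul, add_assoc, ← add_smul, neg_add,
          Real.exp_add]
        push_cast
        congr 2
        ring
      unital := by
        intro t _
        rw [depolarizing_apply, tau_one hn, ← add_smul]
        simp
      cp := fun t ht => isCompletelyPositive_depolarizing ht
      continuous := by
        intro A
        have hc : Continuous fun t : ℝ => depolarizing n t A := by
          simp only [depolarizing_apply]
          fun_prop
        have := (hc.tendsto 0).mono_left (nhdsWithin_le_nhds (s := Set.Ici 0))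
        simpa [depolarizing_apply] using this }
  posDef := Matrix.PosDef.one
  tau_eq_one := tau_one hn
  symm := by
    intro t _ A B
    simp only [depolarizing_apply, mul_one, add_mul, mul_add, tau_add, Matrix.smul_mul,
      Matrix.mul_smul, one_mul, tau_smul]
    ring

/-! ### Existence of a first-order differential calculus

The bimodule consists of the linear maps `T` on `M_n(ℂ)` with `T(1) = 0`, and the derivation maps
`A` to the commutator `Z ↦ A Z - Z A`. -/

section CommutatorCalculus

variable {n : ℕ}

/-- The scalar multiples of the identity. -/
abbrev scalars (n : ℕ) : Submodule ℂ (Mat n) := Submodule.span ℂ {1}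

/-- Linear maps on `M_n(ℂ)` that vanish at the identity. -/
abbrev VanishAtOne (n : ℕ) : Type := (Mat n ⧸ scalars n) →ₗ[ℂ] Mat n

/-- The value of `T` at a matrix. -/
abbrev VanishAtOne.val (T : VanishAtOne n) (Z : Mat n) : Mat n := T ((scalars n).mkQ Z)

theorem VanishAtOne.ext_val {T S : VanishAtOne n} (h : ∀ Z, T.val Z = S.val Z) : T = S := by
  refine LinearMap.ext fun z => ?_
  obtain ⟨Z, rfl⟩ := (scalars n).mkQ_surjective z
  exact h Z

theorem VanishAtOne.val_one (T : VanishAtOne n) : T.val 1 = 0 := by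
  have : (scalars n).mkQ 1 = 0 := by
    rw [Submodule.mkQ_apply, Submodule.Quotient.mk_eq_zero]
    exact Submodule.mem_span_singleton_self 1
  rw [VanishAtOne.val, this, map_zero]

theorem val_eq_sum_single (f : Mat n →ₗ[ℂ] Mat n) (Z : Mat n) :
    f Z = ∑ i, ∑ j, Z i j • f (Matrix.single i j 1) := by
  conv_lhs => rw [Matrix.matrix_eq_sum_single Z]
  simp only [map_sum]
  refine Finset.sum_congr rfl fun i _ => Finset.sum_congr rfl fun j _ => ?_
  rw [← map_smul, Matrix.smul_single, smul_eq_mul, mul_one]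

/-- The linear map vanishing at the identity that is given by a function on matrices. -/
def VanishAtOne.mk (f : Mat n →ₗ[ℂ] Mat n) (hf : f 1 = 0) : VanishAtOne n :=
  (scalars n).liftQ f (by rw [Submodule.span_singleton_le_iff_mem]; exact hf)

/-- The commutator with `A`. -/
def commutator : Mat n →ₗ[ℂ] VanishAtOne n where
  toFun A := VanishAtOne.mk (LinearMap.mulLeft ℂ A - LinearMap.mulRight ℂ A) (by simp)
  map_add' A B := VanishAtOne.ext_val fun Z => by
    change (A + B) * Z - Z * (A + B) = (A * Z - Z * A) + (B * Z - Z * B)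
    noncomm_ring
  map_smul' c A := VanishAtOne.ext_val fun Z => by
    change (c • A) * Z - Z * (c • A) = c • (A * Z - Z * A)
    rw [Matrix.smul_mul, Matrix.mul_smul, smul_sub]

theorem commutator_val (A Z : Mat n) : (commutator A).val Z = A * Z - Z * A := rfl

/-- The involution `T ↦ -T(Z*)*`. -/
def negAdjoint : VanishAtOne n →ₗ⋆[ℂ] VanishAtOne n where
  toFun T := VanishAtOne.mk
    { toFun := fun Z => -(T.val Z.conjTranspose).conjTranspose
      map_add' := fun A B => by simp [VanishAtOne.val]; abel
      map_smul' := fun c A => by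
        simp only [VanishAtOne.val, Matrix.conjTranspose_smul, map_smul, star_star, smul_neg,
          RingHom.id_apply] }
    (by
      change -(T.val (1 : Mat n).conjTranspose).conjTranspose = 0
      rw [Matrix.conjTranspose_one, T.val_one]; simp)
  map_add' T S := VanishAtOne.ext_val fun Z => by
    change -(T.val _ + S.val _).conjTranspose = -(T.val _).conjTranspose + -(S.val _).conjTranspose
    rw [Matrix.conjTranspose_add]; abel
  map_smul' c T := VanishAtOne.ext_val fun Z => by
    change -(c • T.val _).conjTranspose = star c • -(T.val _).conjTranspose
    rw [Matrix.conjTranspose_smul, smul_neg]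

theorem negAdjoint_val (T : VanishAtOne n) (Z : Mat n) :
    (negAdjoint T).val Z = -(T.val Z.conjTranspose).conjTranspose := rfl

/-- The matrix-valued inner product `(T | S) = (2n)⁻¹ ∑ T(e_ij)* S(e_ij)`. -/
def hsInner : VanishAtOne n →ₗ⋆[ℂ] VanishAtOne n →ₗ[ℂ] Mat n :=
  LinearMap.mk₂'ₛₗ (starRingEnd ℂ) (RingHom.id ℂ)
    (fun T S => (2 * (n : ℂ))⁻¹ • ∑ i, ∑ j,
      (T.val (Matrix.single i j 1)).conjTranspose * S.val (Matrix.single i j 1))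
    (fun T T' S => by
      simp only [VanishAtOne.val, LinearMap.add_apply, Matrix.conjTranspose_add, add_mul,
        Finset.sum_add_distrib, smul_add])
    (fun c T S => by
      simp only [VanishAtOne.val, LinearMap.smul_apply, Matrix.conjTranspose_smul, Matrix.smul_mul,
        ← Finset.smul_sum]
      rw [smul_comm]; rfl)
    (fun T S S' => by
      simp only [VanishAtOne.val, LinearMap.add_apply, mul_add,
        Finset.sum_add_distrib, smul_add])
    (fun c T S => by
      simp only [VanishAtOne.val, LinearMap.smul_apply, Matrix.mul_smul, ← Finset.smul_sum]
      rw [smul_comm]; rfl)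

theorem hsInner_apply (T S : VanishAtOne n) : hsInner T S = (2 * (n : ℂ))⁻¹ • ∑ i, ∑ j,
    (T.val (Matrix.single i j 1)).conjTranspose * S.val (Matrix.single i j 1) := rfl

theorem hsInner_self (T : VanishAtOne n) : hsInner T T = (2 * (n : ℝ))⁻¹ • ∑ i, ∑ j,
    (T.val (Matrix.single i j 1)).conjTranspose * T.val (Matrix.single i j 1) := by
  rw [hsInner_apply, ← Complex.coe_smul]
  push_cast
  rfl

theorem hsInner_self_eq_zero (hn : 1 ≤ n) (T : VanishAtOne n) : hsInner T T = 0 ↔ T = 0 := by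
  refine ⟨fun h => ?_, fun h => by rw [h, map_zero]⟩
  have hn' : (2 * (n : ℝ))⁻¹ ≠ 0 := by positivity
  rw [hsInner_self, smul_eq_zero_iff_right hn'] at h
  have htr : ∑ i, ∑ j, ((T.val (Matrix.single i j 1)).conjTranspose *
      T.val (Matrix.single i j 1)).trace = 0 := by
    rw [← Matrix.trace_zero (n := Fin n) (R := ℂ), ← h]
    simp only [Matrix.trace_sum]
  have hnn : ∀ X : Mat n, 0 ≤ (X.conjTranspose * X).trace := fun X =>
    (Matrix.posSemidef_conjTranspose_mul_self X).trace_nonneg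
  have hz : ∀ i j, T.val (Matrix.single i j 1) = 0 := by
    intro i j
    have h1 := (Finset.sum_eq_zero_iff_of_nonneg
      (fun i _ => Finset.sum_nonneg fun j _ => hnn _)).mp htr i (Finset.mem_univ i)
    have h2 := (Finset.sum_eq_zero_iff_of_nonneg (fun j _ => hnn _)).mp h1 j (Finset.mem_univ j)
    exact Matrix.trace_conjTranspose_mul_self_eq_zero_iff.mp h2
  refine VanishAtOne.ext_val fun Z => ?_
  have := val_eq_sum_single (T ∘ₗ (scalars n).mkQ) Z
  change T.val Z = ∑ i, ∑ j, Z i j • T.val (Matrix.single i j 1) at this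
  rw [this]
  simp only [hz, smul_zero, Finset.sum_const_zero]
  rfl

/-! ### Matrix-unit identities and the commutator derivation. -/

theorem sum_single_mul_mul_single (X : Mat n) :
    ∑ i, ∑ j, Matrix.single j i (1 : ℂ) * X * Matrix.single i j 1 = X.trace • (1 : Mat n) := by
  have h : ∀ i j, Matrix.single j i (1 : ℂ) * X * Matrix.single i j 1 =
      Matrix.single j j (X i i) := by
    intro i j
    simp [Matrix.single_mul_mul_single]
  simp only [h]
  rw [Finset.sum_comm]
  simp only [← Matrix.singleAddMonoidHom_apply, ← map_sum]
  simp only [Matrix.singleAddMonoidHom_apply, Matrix.sum_single_eq_diagonal]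
  rw [Matrix.smul_one_eq_diagonal]
  rfl

theorem sum_mul_single_mul (A B : Mat n) :
    ∑ i, ∑ j, (A * Matrix.single i j (1 : ℂ)).conjTranspose * (Matrix.single i j 1 * B) =
      star (A.trace) • B := by
  have h : ∀ i j, (A * Matrix.single i j (1 : ℂ)).conjTranspose * (Matrix.single i j 1 * B) =
      (Matrix.single j i (1 : ℂ) * A.conjTranspose * Matrix.single i j 1) * B := by
    intro i j
    rw [Matrix.conjTranspose_mul, Matrix.conjTranspose_single]
    simp [Matrix.mul_assoc]
  simp only [h, ← Finset.sum_mul, sum_single_mul_mul_single, Matrix.trace_conjTranspose,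
    Matrix.smul_mul, one_mul]

/-- Expanding `[A,E]* [B,E]` over all matrix units `E` gives four sums, each evaluated by `∑ E* X E
= Tr(X) 1`. They are the four terms of the carré du champ up to the factor `n`, and the prefactor
`1/(2n)` in the inner product absorbs it. -/
theorem hsInner_commutator (hn : 1 ≤ n) (A B : Mat n) :
    carre (depolarizing n) A B = hsInner (commutator A) (commutator B) := by
  have hn0 : (n : ℂ) ≠ 0 := by exact_mod_cast (by omega : n ≠ 0)
  have hs : ∑ i : Fin n, ∑ j : Fin n, (Matrix.single i j (1 : ℂ)).conjTranspose *
      Matrix.single i j 1 = (n : ℂ) • (1 : Mat n) := by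
    have := sum_single_mul_mul_single (1 : Mat n)
    simp only [mul_one, Matrix.trace_one, Fintype.card_fin] at this
    simpa [Matrix.conjTranspose_single] using this
  have h1 : ∑ i, ∑ j, (A * Matrix.single i j (1 : ℂ)).conjTranspose * (B * Matrix.single i j 1) =
      (A.conjTranspose * B).trace • (1 : Mat n) := by
    rw [← sum_single_mul_mul_single]
    refine Finset.sum_congr rfl fun i _ => Finset.sum_congr rfl fun j _ => ?_
    rw [Matrix.conjTranspose_mul, Matrix.conjTranspose_single]
    simp [Matrix.mul_assoc]
  have h2 := sum_mul_single_mul A B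
  have h3 : ∑ i, ∑ j, (Matrix.single i j (1 : ℂ) * A).conjTranspose * (B * Matrix.single i j 1) =
      B.trace • A.conjTranspose := by
    have := congrArg Matrix.conjTranspose (sum_mul_single_mul B A)
    simpa [Matrix.conjTranspose_sum, Matrix.conjTranspose_mul, Matrix.mul_assoc] using this
  have h4 : ∑ i, ∑ j, (Matrix.single i j (1 : ℂ) * A).conjTranspose * (Matrix.single i j 1 * B) =
      (n : ℂ) • (A.conjTranspose * B) := by
    have : ∀ i j : Fin n, (Matrix.single i j (1 : ℂ) * A).conjTranspose *
        (Matrix.single i j 1 * B) = A.conjTranspose * ((Matrix.single i j (1 : ℂ)).conjTranspose *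
          Matrix.single i j 1) * B := by
      intro i j
      rw [Matrix.conjTranspose_mul]; simp only [Matrix.mul_assoc]
    simp only [this, ← Finset.sum_mul, ← Finset.mul_sum, hs]
    rw [Matrix.mul_smul, mul_one, Matrix.smul_mul]
  have hsum : ∑ i, ∑ j, ((commutator A).val (Matrix.single i j 1)).conjTranspose *
      (commutator B).val (Matrix.single i j 1) = (A.conjTranspose * B).trace • (1 : Mat n)
        - star A.trace • B - B.trace • A.conjTranspose + (n : ℂ) • (A.conjTranspose * B) := by
    rw [← h1, ← h2, ← h3, ← h4]
    simp only [← Finset.sum_sub_distrib, ← Finset.sum_add_distrib, commutator_val,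
      Matrix.conjTranspose_sub]
    refine Finset.sum_congr rfl fun i _ => Finset.sum_congr rfl fun j _ => ?_
    noncomm_ring
  rw [carre_depolarizing, hsInner_apply, hsum]
  simp only [tau, smul_add, smul_sub, smul_smul, star_mul', star_inv₀, star_natCast]
  have e1 : (2 * (n : ℂ))⁻¹ * n = 1 / 2 := by field_simp
  have e2 : ∀ x : ℂ, (2 * (n : ℂ))⁻¹ * x = 1 / 2 * ((n : ℂ)⁻¹ * x) := by intro x; field_simp
  rw [e1, e2, e2, e2]
  abel

/-- Any `T` equals `∑_{ijk} [e_ki, ·] e_jk T(e_ij)`: the products `e_ki Z e_jk = Z_ij e_kk` rebuild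
`T(Z)`, while the other halves of the commutators add up to `Z T(1)`, which is zero. -/
theorem span_commutator :
    Submodule.span ℂ {ξ : VanishAtOne n | ∃ A B : Mat n, ξ = commutator A <• B} = ⊤ := by
  rw [eq_top_iff]
  intro T _
  have hT : T = ∑ i, ∑ j, ∑ k, commutator (Matrix.single k i (1 : ℂ)) <•
      (Matrix.single j k 1 * T.val (Matrix.single i j 1)) := by
    refine VanishAtOne.ext_val fun Z => ?_
    have hv : (∑ i, ∑ j, ∑ k, commutator (Matrix.single k i (1 : ℂ)) <•
        (Matrix.single j k 1 * T.val (Matrix.single i j 1))).val Z = ∑ i, ∑ j, ∑ k,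
          (Matrix.single k i 1 * Z - Z * Matrix.single k i 1) *
            (Matrix.single j k 1 * T.val (Matrix.single i j 1)) := by
      simp only [VanishAtOne.val, LinearMap.sum_apply]
      rfl
    have hone : ∑ k : Fin n, Matrix.single k k (1 : ℂ) = 1 := Matrix.sum_single_one
    have hfst : ∀ i j k : Fin n, Matrix.single k i 1 * Z * (Matrix.single j k 1 *
        T.val (Matrix.single i j 1)) = Z i j • (Matrix.single k k 1 *
          T.val (Matrix.single i j 1)) := by
      intro i j k
      rw [← Matrix.mul_assoc, Matrix.single_mul_mul_single, ← Matrix.smul_mul, Matrix.smul_single]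
      simp
    have hsnd : ∀ i j k : Fin n, Z * Matrix.single k i 1 * (Matrix.single j k 1 *
        T.val (Matrix.single i j 1)) = Z * (if i = j then Matrix.single k k 1 *
          T.val (Matrix.single i j 1) else 0) := by
      intro i j k
      rw [Matrix.mul_assoc, ← Matrix.mul_assoc (Matrix.single k i 1)]
      by_cases h : i = j
      · subst h; rw [Matrix.single_mul_single_same]; simp
      · rw [Matrix.single_mul_single_of_ne _ _ _ _ h]; simp [h]
    have hzero : ∑ i : Fin n, T.val (Matrix.single i i 1) = 0 := by
      simp only [VanishAtOne.val]
      rw [← map_sum, ← map_sum, hone]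
      exact T.val_one
    rw [hv]
    simp only [sub_mul, Finset.sum_sub_distrib, hfst, hsnd, ← Finset.smul_sum, ← Finset.sum_mul,
      ← Finset.mul_sum, hone, one_mul]
    have hrest : ∑ i : Fin n, ∑ j, ∑ k : Fin n, (if i = j then Matrix.single k k (1 : ℂ) *
        T.val (Matrix.single i j 1) else 0) = 0 := by
      refine Eq.trans (Finset.sum_congr rfl fun i _ => ?_) hzero
      rw [Finset.sum_eq_single i]
      · simp only [if_true, ← Finset.sum_mul, hone, one_mul]
      · intro j _ hj; simp [Ne.symm hj]
      · simp
    rw [hrest, mul_zero, sub_zero]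
    exact val_eq_sum_single (T ∘ₗ (scalars n).mkQ) Z
  rw [hT]
  exact Submodule.sum_mem _ fun i _ => Submodule.sum_mem _ fun j _ => Submodule.sum_mem _ fun k _ =>
    Submodule.subset_span ⟨_, _, rfl⟩

theorem hsInner_negAdjoint (T S : VanishAtOne n) :
    tau (hsInner (negAdjoint T) (negAdjoint S)) = tau (hsInner S T) := by
  rw [hsInner_apply, hsInner_apply, tau_smul, tau_smul]
  congr 1
  simp only [tau_sum]
  rw [Finset.sum_comm]
  refine Finset.sum_congr rfl fun i _ => Finset.sum_congr rfl fun j _ => ?_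
  rw [negAdjoint_val, negAdjoint_val, Matrix.conjTranspose_single, star_one,
    Matrix.conjTranspose_neg, Matrix.conjTranspose_conjTranspose, neg_mul_neg, tau_mul_comm]

/-- The first-order differential calculus of commutators. -/
def commutatorCalculus (hn : 1 ≤ n) : FirstOrderCalculus.{0} (1 : Mat n) (depolarizing n) where
  -- Both actions are the pointwise ones coming from the target algebra; vanishing at `1` is built
  -- into the domain being a quotient, so no submodule has to be shown stable.
  F := VanishAtOne n
  ip := hsInner
  ip_smul T S A B := by
    rw [hsInner_apply, hsInner_apply, Matrix.smul_mul, Finset.sum_mul]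
    congr 1
    refine Finset.sum_congr rfl fun i _ => ?_
    rw [Finset.sum_mul]
    refine Finset.sum_congr rfl fun j _ => ?_
    change _ * (A * S.val _ * B) = (A.conjTranspose * T.val _).conjTranspose * _ * B
    rw [Matrix.conjTranspose_mul, Matrix.conjTranspose_conjTranspose]
    simp only [Matrix.mul_assoc]
  ip_nonneg T := by
    rw [hsInner_self]
    refine Matrix.PosSemidef.smul ?_ (by positivity)
    exact Matrix.posSemidef_sum _ fun a _ => Matrix.posSemidef_sum _ fun b _ =>
      Matrix.posSemidef_conjTranspose_mul_self _
  ip_self_eq_zero := hsInner_self_eq_zero hn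
  V _ := LinearMap.id
  V_zero := rfl
  V_add _ _ := rfl
  V_isometry _ _ := rfl
  V_continuous T := by simp [opNorm]
  J := negAdjoint
  d := commutator
  leibniz A B := VanishAtOne.ext_val fun Z => by
    change A * B * Z - Z * (A * B) = A * (B * Z - Z * B) + (A * Z - Z * A) * B
    noncomm_ring
  V_smul t A B T := by simp [mpow_one_left]
  J_smul A B T := VanishAtOne.ext_val fun Z => by
    simp only [mpow_one_left, one_mul, mul_one]
    change -(A * T.val _ * B).conjTranspose =
      B.conjTranspose * (-(T.val _).conjTranspose) * A.conjTranspose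
    rw [Matrix.conjTranspose_mul, Matrix.conjTranspose_mul]
    noncomm_ring
  J_ip T S := by rw [mul_one, mul_one, hsInner_negAdjoint]
  J_V _ _ := rfl
  d_modular t A := by simp [mpow_one_left]
  d_conj A := VanishAtOne.ext_val fun Z => by
    simp only [mpow_one_left, one_mul, mul_one]
    rw [commutator_val, negAdjoint_val, commutator_val, Matrix.conjTranspose_sub,
      Matrix.conjTranspose_mul, Matrix.conjTranspose_mul, Matrix.conjTranspose_conjTranspose]
    abel
  span_eq_top := span_commutator
  carre_eq := hsInner_commutator hn

end CommutatorCalculus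

/-! ### Diagonalization -/

section Diagonalization

variable {n : ℕ}

/-- The Hermitian matrix with eigenvectors the columns of `U` and eigenvalues `l`. -/
def conjDiag (U : Mat n) (l : Fin n → ℝ) : Mat n :=
  U * Matrix.diagonal (fun i => (l i : ℂ)) * U.conjTranspose

/-- The projection onto the `k`-th column of a unitary matrix. -/
def colProj (U : Mat n) (k : Fin n) : Mat n := U * Matrix.single k k 1 * U.conjTranspose

theorem conjDiag_apply (U : Mat n) (l : Fin n → ℝ) (i j : Fin n) :
    conjDiag U l i j = ∑ k, U i k * l k * star (U j k) := by
  rw [conjDiag, Matrix.mul_apply]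
  simp only [Matrix.mul_diagonal, Matrix.conjTranspose_apply]

theorem exists_eq_conjDiag_of_posDef {A : Mat n} (hA : A.PosDef) :
    ∃ U ∈ Matrix.unitaryGroup (Fin n) ℂ, ∃ l : Fin n → ℝ, (∀ i, 0 < l i) ∧ A = conjDiag U l := by
  refine ⟨hA.1.eigenvectorUnitary, hA.1.eigenvectorUnitary.2, hA.1.eigenvalues,
    hA.eigenvalues_pos, ?_⟩
  conv_lhs => rw [hA.1.spectral_theorem]
  rfl

variable {U : Mat n}

theorem conjTranspose_mul_self_of_mem_unitaryGroup (hU : U ∈ Matrix.unitaryGroup (Fin n) ℂ) :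
    U.conjTranspose * U = 1 := Matrix.mem_unitaryGroup_iff'.mp hU

theorem mul_conjTranspose_self_of_mem_unitaryGroup (hU : U ∈ Matrix.unitaryGroup (Fin n) ℂ) :
    U * U.conjTranspose = 1 := Matrix.mem_unitaryGroup_iff.mp hU

theorem conj_mul_conj (hU : U ∈ Matrix.unitaryGroup (Fin n) ℂ) (X Y : Mat n) :
    (U * X * U.conjTranspose) * (U * Y * U.conjTranspose) = U * (X * Y) * U.conjTranspose := by
  have h := conjTranspose_mul_self_of_mem_unitaryGroup hU
  calc _ = U * X * (U.conjTranspose * U) * Y * U.conjTranspose := by simp only [Matrix.mul_assoc]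
    _ = _ := by rw [h, mul_one]; simp only [Matrix.mul_assoc]

theorem trace_conj (hU : U ∈ Matrix.unitaryGroup (Fin n) ℂ) (X : Mat n) :
    (U * X * U.conjTranspose).trace = X.trace := by
  rw [Matrix.trace_mul_comm, ← Matrix.mul_assoc, conjTranspose_mul_self_of_mem_unitaryGroup hU,
    one_mul]

theorem conjDiag_isHermitian (l : Fin n → ℝ) : (conjDiag U l).IsHermitian := by
  rw [Matrix.IsHermitian, conjDiag, Matrix.conjTranspose_mul, Matrix.conjTranspose_mul,
    Matrix.conjTranspose_conjTranspose, Matrix.diagonal_conjTranspose, Matrix.mul_assoc]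
  congr 3
  ext i
  simp

theorem conjDiag_posSemidef {l : Fin n → ℝ} (hl : ∀ i, 0 ≤ l i) : (conjDiag U l).PosSemidef := by
  refine Matrix.PosSemidef.mul_mul_conjTranspose_same ?_ U
  exact Matrix.PosSemidef.diagonal fun i => by simpa using hl i

theorem conjDiag_const (hU : U ∈ Matrix.unitaryGroup (Fin n) ℂ) (c : ℝ) :
    conjDiag U (fun _ => c) = (c : ℂ) • (1 : Mat n) := by
  rw [conjDiag, ← Matrix.smul_one_eq_diagonal, Matrix.mul_smul, mul_one, Matrix.smul_mul,
    mul_conjTranspose_self_of_mem_unitaryGroup hU]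

theorem conjDiag_add (l m : Fin n → ℝ) :
    conjDiag U (fun i => l i + m i) = conjDiag U l + conjDiag U m := by
  rw [conjDiag, conjDiag, conjDiag, ← add_mul, ← mul_add, Matrix.diagonal_add]
  simp

theorem conjDiag_smul (c : ℝ) (l : Fin n → ℝ) :
    conjDiag U (fun i => c * l i) = (c : ℂ) • conjDiag U l := by
  rw [conjDiag, conjDiag, ← Matrix.smul_mul, ← Matrix.mul_smul, ← Matrix.diagonal_smul]
  congr 3
  ext i
  simp

theorem trace_conjDiag (hU : U ∈ Matrix.unitaryGroup (Fin n) ℂ) (l : Fin n → ℝ) :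
    (conjDiag U l).trace = ((∑ i, l i : ℝ) : ℂ) := by
  rw [conjDiag, trace_conj hU, Matrix.trace_diagonal]; simp

theorem conjDiag_mul (hU : U ∈ Matrix.unitaryGroup (Fin n) ℂ) (l m : Fin n → ℝ) :
    conjDiag U l * conjDiag U m = conjDiag U (fun i => l i * m i) := by
  rw [conjDiag, conjDiag, conj_mul_conj hU, Matrix.diagonal_mul_diagonal, conjDiag]
  simp

/-- On the finite spectrum `f` agrees with an interpolating polynomial, and for polynomials the
claim is algebra. -/
theorem cfc_conjDiag (hU : U ∈ Matrix.unitaryGroup (Fin n) ℂ) (f : ℝ → ℝ) (l : Fin n → ℝ) :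
    cfc f (conjDiag U l) = conjDiag U (fun i => f (l i)) := by
  classical
  have hsa : IsSelfAdjoint (conjDiag U l) := conjDiag_isHermitian l
  have hspec : spectrum ℝ (conjDiag U l) ⊆ Set.range l := by
    intro x hx
    have h1 : (x : ℂ) ∈ spectrum ℂ (conjDiag U l) := by
      have := spectrum.algebraMap_mem (S := ℂ) hx
      simpa using this
    have h2 : conjDiag U l = ((⟨U, hU⟩ : unitary (Mat n)) : Mat n) *
        Matrix.diagonal (fun i => (l i : ℂ)) * (star (⟨U, hU⟩ : unitary (Mat n)) : Mat n) := rfl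
    rw [h2, Unitary.spectrum_star_right_conjugate, spectrum_diagonal] at h1
    obtain ⟨i, hi⟩ := h1
    exact ⟨i, Complex.ofReal_injective hi⟩
  set q := Lagrange.interpolate (Finset.univ.image l) id f with hq
  have hqe : ∀ i, q.eval (l i) = f (l i) := fun i => by
    have := Lagrange.eval_interpolate_at_node f (v := id) (s := Finset.univ.image l)
      (Set.injOn_id _) (Finset.mem_image_of_mem l (Finset.mem_univ i))
    exact this
  have h1 : cfc f (conjDiag U l) = cfc q.eval (conjDiag U l) := by
    refine cfc_congr fun x hx => ?_
    obtain ⟨i, rfl⟩ := hspec hx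
    exact (hqe i).symm
  have h2 : ∀ p : Polynomial ℝ, Polynomial.aeval (conjDiag U l) p =
      conjDiag U (fun i => p.eval (l i)) := by
    intro p
    induction p using Polynomial.induction_on' with
    | add p q hp hq => simp only [map_add, hp, hq, Polynomial.eval_add, conjDiag_add]
    | monomial k a =>
      have hk : ∀ k : ℕ, conjDiag U l ^ k = conjDiag U (fun i => l i ^ k) := by
        intro k
        induction k with
        | zero => simp [conjDiag_const hU]
        | succ k ih => simp only [pow_succ, ih, conjDiag_mul hU]
      rw [Polynomial.aeval_monomial, hk]
      simp only [Polynomial.eval_monomial, conjDiag_smul]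
      rw [← Algebra.smul_def, Complex.coe_smul]
  rw [h1, cfc_polynomial _ _ hsa, h2]
  simp only [hqe]

theorem mpow_conjDiag (hU : U ∈ Matrix.unitaryGroup (Fin n) ℂ) (l : Fin n → ℝ) (z : ℝ) :
    mpow (conjDiag U l) z = conjDiag U (fun i => Real.exp (z * Real.log (l i))) := by
  have hinv : U⁻¹ = U.conjTranspose :=
    Matrix.inv_eq_right_inv (mul_conjTranspose_self_of_mem_unitaryGroup hU)
  have hu : IsUnit U := by
    rw [Matrix.isUnit_iff_isUnit_det]
    exact Matrix.isUnit_det_of_right_inverse (mul_conjTranspose_self_of_mem_unitaryGroup hU)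
  rw [mpow, cfc_conjDiag hU, ← conjDiag_smul, conjDiag, ← hinv, Matrix.exp_conj _ _ hu,
    Matrix.exp_diagonal, conjDiag, hinv]
  congr 3
  ext i
  rw [Pi.coe_exp, Complex.exp_eq_exp_ℂ.symm]
  simp

theorem colProj_conjTranspose (k : Fin n) : (colProj U k).conjTranspose = colProj U k := by
  rw [colProj, Matrix.conjTranspose_mul, Matrix.conjTranspose_mul,
    Matrix.conjTranspose_conjTranspose, Matrix.conjTranspose_single, Matrix.mul_assoc, star_one]

theorem sum_colProj (hU : U ∈ Matrix.unitaryGroup (Fin n) ℂ) : ∑ k, colProj U k = 1 := by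
  simp only [colProj, ← Finset.sum_mul, ← Finset.mul_sum, Matrix.sum_single_one]
  rw [mul_one, mul_conjTranspose_self_of_mem_unitaryGroup hU]

theorem conjDiag_mul_colProj (hU : U ∈ Matrix.unitaryGroup (Fin n) ℂ) (l : Fin n → ℝ)
    (k : Fin n) : conjDiag U l * colProj U k = (l k : ℂ) • colProj U k := by
  rw [conjDiag, colProj, conj_mul_conj hU, ← Matrix.smul_mul, ← Matrix.mul_smul]
  congr 2
  ext i j
  simp only [Matrix.diagonal_mul, Matrix.smul_apply, Matrix.single_apply, smul_eq_mul]
  grind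

theorem colProj_mul_conjDiag (hU : U ∈ Matrix.unitaryGroup (Fin n) ℂ) (l : Fin n → ℝ)
    (k : Fin n) : colProj U k * conjDiag U l = (l k : ℂ) • colProj U k := by
  rw [conjDiag, colProj, conj_mul_conj hU, ← Matrix.smul_mul, ← Matrix.mul_smul]
  congr 2
  ext i j
  simp only [Matrix.mul_diagonal, Matrix.smul_apply, Matrix.single_apply, smul_eq_mul]
  grind

theorem tau_colProj_mul (k : Fin n) (X : Mat n) :
    tau (colProj U k * X) = (n : ℂ)⁻¹ * (U.conjTranspose * X * U) k k := by
  rw [colProj, tau, Matrix.mul_assoc, Matrix.mul_assoc, Matrix.trace_mul_comm, Matrix.mul_assoc,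
    Matrix.trace_single_mul, one_smul]

/-- Each eigenvalue of a positive semidefinite matrix is at most their sum. -/
theorem trace_smul_one_sub_posSemidef {A : Mat n} (hA : A.PosSemidef) :
    (A.trace • (1 : Mat n) - A).PosSemidef := by
  have hl : ∀ i, 0 ≤ hA.1.eigenvalues i := hA.eigenvalues_nonneg
  have hAU : A = conjDiag hA.1.eigenvectorUnitary hA.1.eigenvalues := by
    conv_lhs => rw [hA.1.spectral_theorem]
    rfl
  have hU := hA.1.eigenvectorUnitary.2
  generalize (hA.1.eigenvectorUnitary : Mat n) = U at hAU hU
  generalize hA.1.eigenvalues = l at hAU hl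
  have : A.trace • (1 : Mat n) - A = conjDiag U (fun i => (∑ j, l j) + (-1) * l i) := by
    rw [conjDiag_add, conjDiag_const hU, conjDiag_smul, ← trace_conjDiag hU, ← hAU]
    simp [sub_eq_add_neg]
  rw [this]
  refine conjDiag_posSemidef fun i => ?_
  have := Finset.single_le_sum (fun j _ => hl j) (Finset.mem_univ i)
  linarith

end Diagonalization

/-! ### First-order differential calculi of the depolarizing semigroup -/

namespace FirstOrderCalculus

section General

variable {n : ℕ} {σ : Mat n} {P : ℝ → Mat n →ₗ[ℂ] Mat n} (C : FirstOrderCalculus.{u} σ P)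

theorem ip_op_smul_right (ξ η : C.F) (B : Mat n) : C.ip ξ (η <• B) = C.ip ξ η * B := by
  simpa using C.ip_smul ξ η 1 B

theorem ip_smul_right (ξ η : C.F) (A : Mat n) : C.ip ξ (A •> η) = C.ip (A.conjTranspose •> ξ) η := by
  simpa using C.ip_smul ξ η A 1

/-- Hermitian symmetry is not an axiom of the calculus. It follows by polarization, as `(ζ | ζ)` is
Hermitian for `ζ = ξ + η` and `ζ = ξ + iη`. -/
theorem ip_conjTranspose (ξ η : C.F) : (C.ip ξ η).conjTranspose = C.ip η ξ := by
  have h1 : (C.ip (ξ + η) (ξ + η)).conjTranspose = C.ip (ξ + η) (ξ + η) := (C.ip_nonneg _).1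
  have h2 : (C.ip (ξ + Complex.I • η) (ξ + Complex.I • η)).conjTranspose =
      C.ip (ξ + Complex.I • η) (ξ + Complex.I • η) := (C.ip_nonneg _).1
  have hξ : (C.ip ξ ξ).conjTranspose = C.ip ξ ξ := (C.ip_nonneg _).1
  have hη : (C.ip η η).conjTranspose = C.ip η η := (C.ip_nonneg _).1
  simp only [map_add, LinearMap.add_apply, Matrix.conjTranspose_add, hξ, hη, map_smulₛₗ,
    LinearMap.smul_apply, Matrix.conjTranspose_smul, RingHom.id_apply, Complex.conj_I] at h1 h2
  simp only [star_neg, Complex.star_def, Complex.conj_I] at h2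
  ext i j
  have e1 := congrFun (congrFun h1 i) j
  have e2 := congrFun (congrFun h2 i) j
  simp only [Matrix.add_apply, Matrix.smul_apply, smul_eq_mul] at e1 e2
  linear_combination (1 / 2 : ℂ) * e1 + (Complex.I / 2) * e2 +
    (1 / 2) * ((C.ip ξ η).conjTranspose i j - (C.ip η ξ).conjTranspose i j + C.ip ξ η i j
      - C.ip η ξ i j) * Complex.I_sq

theorem ip_op_smul_left (ξ η : C.F) (B : Mat n) :
    C.ip (ξ <• B) η = B.conjTranspose * C.ip ξ η := by
  rw [← C.ip_conjTranspose, C.ip_op_smul_right, Matrix.conjTranspose_mul, C.ip_conjTranspose]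

theorem d_one : C.d 1 = 0 := by
  have := C.leibniz 1 1
  simpa using this

theorem smul_d (A B : Mat n) : A •> C.d B = C.d (A * B) - C.d A <• B := by
  rw [C.leibniz, add_sub_cancel_right]

theorem tau_ip_nonneg (ξ : C.F) : 0 ≤ tau (C.ip ξ ξ) :=
  mul_nonneg (by positivity) (C.ip_nonneg ξ).trace_nonneg

end General

variable {n : ℕ} (C : FirstOrderCalculus.{u} (1 : Mat n) (depolarizing n))

theorem d_depolarizing (t : ℝ) (A : Mat n) :
    C.d (depolarizing n t A) = (Real.exp (-t) : ℂ) • C.d A := by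
  rw [depolarizing_apply, map_add, map_smul, map_smul, C.d_one, smul_zero, add_zero]

/-- With `σ = 1` the covariance axioms say that `V_t` fixes each `d A <• B`, and these span. -/
theorem V_eq_id (t : ℝ) : C.V t = LinearMap.id := by
  refine LinearMap.ext fun ξ => ?_
  have hξ : ξ ∈ Submodule.span ℂ {ξ : C.F | ∃ A B : Mat n, ξ = C.d A <• B} := by
    rw [C.span_eq_top]; trivial
  induction hξ using Submodule.span_induction with
  | mem ξ h =>
    obtain ⟨A, B, rfl⟩ := h
    have h1 := C.V_smul t 1 B (C.d A)
    have h2 := C.d_modular t A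
    simp only [mpow_one_left, one_mul, mul_one, one_smul] at h1 h2
    rw [h1, ← h2, LinearMap.id_apply]
  | zero => simp
  | add ξ η _ _ h1 h2 => rw [map_add, h1, h2, map_add]
  | smul c ξ _ h => rw [map_smul, h, map_smul]

theorem ip_d_d (A B : Mat n) : C.ip (C.d A) (C.d B) =
    (1 / 2 : ℂ) • (A.conjTranspose * B - star (tau A) • B - tau B • A.conjTranspose
      + tau (A.conjTranspose * B) • (1 : Mat n)) := by
  rw [← C.carre_eq, carre_depolarizing]

theorem tau_ip_d_d (hn : 1 ≤ n) (A B : Mat n) : tau (C.ip (C.d A) (C.d B)) =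
    tau (A.conjTranspose * B) - star (tau A) * tau B := by
  rw [C.ip_d_d, tau_smul, tau_add, tau_sub, tau_sub, tau_smul, tau_smul, tau_smul, tau_one hn,
    tau_conjTranspose]
  ring

/-! ### The intertwining semigroup -/

/-- The adjoint of the derivation for the scalar products given by `τ`. -/
def dAdj : C.F →ₗ[ℂ] Mat n where
  toFun ξ := Matrix.of fun i j => (C.ip (C.d (Matrix.single i j 1)) ξ).trace
  map_add' ξ η := by ext i j; simp [Matrix.trace_add]
  map_smul' c ξ := by ext i j; simp [Matrix.trace_smul]

theorem tau_mul_dAdj (A : Mat n) (ξ : C.F) :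
    tau (A.conjTranspose * C.dAdj ξ) = tau (C.ip (C.d A) ξ) := by
  rw [tau_conjTranspose_mul, tau]
  congr 1
  conv_rhs => rw [Matrix.matrix_eq_sum_single A]
  simp only [map_sum, LinearMap.sum_apply, Matrix.trace_sum]
  refine Finset.sum_congr rfl fun i _ => Finset.sum_congr rfl fun j _ => ?_
  have h : Matrix.single i j (A i j) = A i j • Matrix.single i j (1 : ℂ) := by
    rw [Matrix.smul_single, smul_eq_mul, mul_one]
  rw [h, map_smul, map_smulₛₗ, LinearMap.smul_apply, Matrix.trace_smul]
  rfl

theorem eq_of_forall_tau_mul_eq {X Y : Mat n} (hn : 1 ≤ n)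
    (h : ∀ A : Mat n, tau (A.conjTranspose * X) = tau (A.conjTranspose * Y)) : X = Y := by
  have hn0 : (n : ℂ)⁻¹ ≠ 0 := inv_ne_zero (by exact_mod_cast (by omega : n ≠ 0))
  ext i j
  have := h (Matrix.single i j 1)
  rw [Matrix.conjTranspose_single, star_one, tau_mul_single, tau_mul_single] at this
  exact mul_left_cancel₀ hn0 this

/-- The adjoint composed with `d` is the generator, here the projection that removes the scalar
part. Hence `d ∘ dAdj` is already a projection, and no inverse of the generator is needed. -/
theorem dAdj_d (hn : 1 ≤ n) (A : Mat n) : C.dAdj (C.d A) = A - tau A • (1 : Mat n) := by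
  refine eq_of_forall_tau_mul_eq hn fun B => ?_
  rw [C.tau_mul_dAdj, C.tau_ip_d_d hn, mul_sub, tau_sub, Matrix.mul_smul, mul_one, tau_smul,
    tau_conjTranspose]
  ring

/-- The orthogonal projection onto the range of the derivation. -/
def proj : C.F →ₗ[ℂ] C.F := C.d ∘ₗ C.dAdj

theorem proj_apply (ξ : C.F) : C.proj ξ = C.d (C.dAdj ξ) := rfl

theorem proj_d (hn : 1 ≤ n) (A : Mat n) : C.proj (C.d A) = C.d A := by
  rw [proj_apply, C.dAdj_d hn, map_sub, map_smul, C.d_one, smul_zero, sub_zero]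

theorem proj_proj (hn : 1 ≤ n) (ξ : C.F) : C.proj (C.proj ξ) = C.proj ξ := C.proj_d hn _

theorem tau_ip_d_sub_proj (hn : 1 ≤ n) (A : Mat n) (ξ : C.F) :
    tau (C.ip (C.d A) (ξ - C.proj ξ)) = 0 := by
  have h1 : tau (C.dAdj ξ) = 0 := by
    have := C.tau_mul_dAdj 1 ξ
    rw [C.d_one, map_zero, LinearMap.zero_apply, Matrix.conjTranspose_one, one_mul] at this
    rw [this]; simp [tau]
  rw [map_sub, tau_sub, proj_apply, C.tau_ip_d_d hn, h1, ← C.tau_mul_dAdj]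
  ring

theorem J_d (A : Mat n) : C.J (C.d A) = C.d A.conjTranspose := by
  have := C.d_conj A
  simpa only [mpow_one_left, one_mul, mul_one] using this.symm

/-- `J` is antiunitary for the `τ`-scalar product and maps the range of `d` to itself, so it
commutes with the orthogonal projection onto that range. -/
theorem J_proj (hn : 1 ≤ n) (ξ : C.F) : C.J (C.proj ξ) = C.proj (C.J ξ) := by
  rw [proj_apply, C.J_d, proj_apply]
  congr 1
  refine eq_of_forall_tau_mul_eq hn fun B => ?_
  rw [C.tau_mul_dAdj, ← Matrix.conjTranspose_conjTranspose B, ← C.J_d]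
  have hJ := C.J_ip (C.d B.conjTranspose) ξ
  rw [mul_one, mul_one] at hJ
  rw [hJ, ← C.ip_conjTranspose, tau_conjTranspose, ← C.tau_mul_dAdj, ← tau_conjTranspose,
    Matrix.conjTranspose_mul, Matrix.conjTranspose_conjTranspose, tau_mul_comm]

/-- After subtracting the trace part, `Γ(B,B) = ½(B*B + τ(B*B))` has trace `τ(B*B)`, and the gap is
`(Tr(B*B) − B*B)/(n+1) ≥ 0`. This is where the `n + 1` in the curvature comes from. -/
theorem smul_ip_d_le (hn : 1 ≤ n) (A : Mat n) : LoewnerLE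
    ((2 / ((n : ℝ) + 1) : ℝ) • C.ip (C.d A) (C.d A)) (tau (C.ip (C.d A) (C.d A)) • (1 : Mat n)) := by
  have hn0 : (n : ℂ) ≠ 0 := by exact_mod_cast (by omega : n ≠ 0)
  have hn1 : (n : ℂ) + 1 ≠ 0 := by exact_mod_cast (by omega : n + 1 ≠ 0)
  obtain ⟨B, hB, hd⟩ : ∃ B : Mat n, tau B = 0 ∧ C.d A = C.d B := by
    refine ⟨A - tau A • (1 : Mat n), ?_, ?_⟩
    · rw [tau_sub, tau_smul, tau_one hn]; ring
    · rw [map_sub, map_smul, C.d_one, smul_zero, sub_zero]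
  have key : tau (C.ip (C.d B) (C.d B)) • (1 : Mat n) -
      (2 / ((n : ℝ) + 1) : ℝ) • C.ip (C.d B) (C.d B) = (1 / ((n : ℝ) + 1)) •
        ((B.conjTranspose * B).trace • (1 : Mat n) - B.conjTranspose * B) := by
    have ht : (B.conjTranspose * B).trace = n * tau (B.conjTranspose * B) := by
      rw [tau]; field_simp
    rw [C.tau_ip_d_d hn, C.ip_d_d, hB, ht, ← Complex.coe_smul, ← Complex.coe_smul]
    push_cast
    ext i j
    simp only [Matrix.sub_apply, Matrix.add_apply, Matrix.smul_apply, smul_eq_mul, star_zero,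
      zero_mul, sub_zero]
    field_simp
    ring
  rw [LoewnerLE, hd, key]
  exact (trace_smul_one_sub_posSemidef (Matrix.posSemidef_conjTranspose_mul_self B)).smul
    (by positivity)

/-- The semigroup on the bimodule with generator `1 + κ (1 - p)`, where `p` is the projection onto
the range of the derivation. -/
def vecSemigroup (κ t : ℝ) : C.F →ₗ[ℂ] C.F :=
  (Real.exp (-t) : ℂ) • (C.proj + (Real.exp (-κ * t) : ℂ) • (LinearMap.id - C.proj))

theorem vecSemigroup_apply (κ t : ℝ) (ξ : C.F) : C.vecSemigroup κ t ξ =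
    (Real.exp (-t) : ℂ) • (C.proj ξ + (Real.exp (-κ * t) : ℂ) • (ξ - C.proj ξ)) := rfl

/-- Split `ξ` into its projection and the orthogonal remainder `η`. With `u = e^{-t}` and `c =
e^{-κt}`, the factor on the right is `e^{-2Kt} = uc`. Both sides then carry the cross terms with the
coefficient `u² c`, so these cancel; their traces vanish by orthogonality. -/
theorem vecSemigroup_estimate (hn : 1 ≤ n) {t : ℝ} (ht : 0 ≤ t) (ξ : C.F) :
    LoewnerLE (C.ip (C.vecSemigroup (2 / ((n : ℝ) + 1)) t ξ)
        (C.vecSemigroup (2 / ((n : ℝ) + 1)) t ξ))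
      ((Real.exp (-2 * (1 / 2 + 1 / ((n : ℝ) + 1)) * t) : ℂ) • depolarizing n t (C.ip ξ ξ)) := by
  have hle := C.smul_ip_d_le hn (C.dAdj ξ)
  have horth := C.tau_ip_d_sub_proj hn (C.dAdj ξ) ξ
  rw [← proj_apply] at hle horth
  have hκ0 : 0 < 2 / ((n : ℝ) + 1) := by positivity
  have hκ1 : 2 / ((n : ℝ) + 1) ≤ 1 := by
    rw [div_le_one (by positivity)]
    have : (1 : ℝ) ≤ n := by exact_mod_cast hn
    linarith
  have hK : -2 * (1 / 2 + 1 / ((n : ℝ) + 1)) * t = -t + -(2 / ((n : ℝ) + 1)) * t := by ring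
  rw [hK, Real.exp_add, vecSemigroup_apply]
  generalize 2 / ((n : ℝ) + 1) = κ at *
  set u := Real.exp (-t) with hu
  set c := Real.exp (-κ * t) with hc
  have hu0 : 0 < u := Real.exp_pos _
  have hc0 : 0 < c := Real.exp_pos _
  have hu1 : u ≤ 1 := Real.exp_le_one_iff.mpr (by linarith)
  have hc1 : c ≤ 1 := Real.exp_le_one_iff.mpr (by nlinarith)
  -- Divided by `uc/κ`, this is `e^{κt} − 1 ≤ κ(e^t − 1)`, the convexity of `exp` for `0 < κ ≤ 1`.
  have hcu : u * (1 - c) / κ ≤ c * (1 - u) := by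
    have hconv : Real.exp (κ * t) ≤ κ * Real.exp t + (1 - κ) := by
      have := convexOn_exp.2 (Set.mem_univ t) (Set.mem_univ 0) hκ0.le (sub_nonneg.mpr hκ1)
        (by ring)
      simpa using this
    have h1 : u * Real.exp t = 1 := by rw [hu, ← Real.exp_add]; simp
    have h2 : c * Real.exp (κ * t) = 1 := by rw [hc, ← Real.exp_add]; simp
    rw [div_le_iff₀ hκ0]
    have h3 := mul_le_mul_of_nonneg_left hconv (mul_nonneg hu0.le hc0.le)
    have h4 : u * c * Real.exp (κ * t) = u := by rw [mul_assoc, h2, mul_one]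
    have h5 : u * c * (κ * Real.exp t + (1 - κ)) = c * κ + u * c * (1 - κ) := by
      linear_combination c * κ * h1
    nlinarith
  obtain ⟨η, hη⟩ : ∃ η, η = ξ - C.proj ξ := ⟨_, rfl⟩
  have hξ : ξ = C.proj ξ + η := by rw [hη]; abel
  rw [← hη] at horth ⊢
  have hsplit : C.ip ξ ξ = C.ip (C.proj ξ) (C.proj ξ) + C.ip (C.proj ξ) η + C.ip η (C.proj ξ) +
      C.ip η η := by
    conv_lhs => rw [hξ]
    simp only [map_add, LinearMap.add_apply]
    abel
  have horth' : tau (C.ip η (C.proj ξ)) = 0 := by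
    rw [← C.ip_conjTranspose, tau_conjTranspose, horth, star_zero]
  have htau : tau (C.ip ξ ξ) = tau (C.ip (C.proj ξ) (C.proj ξ)) + tau (C.ip η η) := by
    rw [hsplit, tau_add, tau_add, tau_add, horth, horth']; ring
  have hτ1 := C.tau_ip_nonneg (C.proj ξ)
  have hτ2 := C.tau_ip_nonneg η
  have hη0 := C.ip_nonneg η
  -- The coefficient `u²(1-c)/κ` of the gap in `smul_ip_d_le` is chosen to absorb the whole `(pξ |
  -- pξ)` term; `hcu` makes the leftover multiple of `1` nonnegative.
  have hdiff : ((u * c : ℝ) : ℂ) • depolarizing n t (C.ip ξ ξ) -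
      C.ip ((u : ℂ) • (C.proj ξ + (c : ℂ) • η)) ((u : ℂ) • (C.proj ξ + (c : ℂ) • η)) =
      (u ^ 2 * c * (1 - c)) • C.ip η η + (u * c * (1 - u)) • (tau (C.ip η η) • (1 : Mat n)) +
      (u ^ 2 * (1 - c) / κ) • (tau (C.ip (C.proj ξ) (C.proj ξ)) • (1 : Mat n) -
        κ • C.ip (C.proj ξ) (C.proj ξ)) +
      (u * (c * (1 - u) - u * (1 - c) / κ)) •
        (tau (C.ip (C.proj ξ) (C.proj ξ)) • (1 : Mat n)) := by
    have hκ' : (κ : ℂ) ≠ 0 := by exact_mod_cast hκ0.ne'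
    rw [depolarizing_apply, htau, hsplit]
    simp only [map_add, LinearMap.add_apply, map_smulₛₗ, LinearMap.smul_apply, RingHom.id_apply,
      Complex.conj_ofReal, ← hu, ← Complex.coe_smul]
    push_cast
    ext i j
    simp only [Matrix.sub_apply, Matrix.add_apply, Matrix.smul_apply, smul_eq_mul]
    field_simp
    ring
  have hone : ∀ z : ℂ, 0 ≤ z → (z • (1 : Mat n)).PosSemidef := fun z hz =>
    Matrix.PosSemidef.one.smul hz
  rw [LoewnerLE, hdiff]
  refine (((hη0.smul ?_).add ((hone _ hτ2).smul ?_)).add (hle.smul ?_)).add ((hone _ hτ1).smul ?_)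
  · have : 0 ≤ 1 - c := by linarith
    positivity
  · have : 0 ≤ 1 - u := by linarith
    positivity
  · have : 0 ≤ 1 - c := by linarith
    positivity
  · exact mul_nonneg hu0.le (by linarith)

theorem intertwiningCurvatureGE (hn : 1 ≤ n) :
    C.IntertwiningCurvatureGE (1 / 2 + 1 / ((n : ℝ) + 1)) := by
  refine ⟨C.vecSemigroup (2 / ((n : ℝ) + 1)), ?_, ?_, ?_, ?_, ?_, ?_, ?_⟩
  · refine LinearMap.ext fun ξ => ?_
    simp [vecSemigroup_apply]
  · intro s t _ _
    refine LinearMap.ext fun ξ => ?_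
    simp only [LinearMap.comp_apply, vecSemigroup_apply, map_add, map_smul, map_sub,
      C.proj_proj hn, sub_self, smul_zero, add_zero]
    rw [show -(s + t) = -s + -t by ring, mul_add, Real.exp_add, Real.exp_add]
    push_cast
    module
  · intro ξ
    have h : ∀ t : ℝ, C.vecSemigroup (2 / ((n : ℝ) + 1)) t ξ - ξ = ((Real.exp (-t) : ℂ) - 1) • C.proj ξ
        + ((Real.exp (-t) : ℂ) * (Real.exp (-(2 / ((n : ℝ) + 1)) * t) : ℂ) - 1) • (ξ - C.proj ξ) := by
      intro t
      rw [vecSemigroup_apply]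
      module
    have hc : Continuous fun t : ℝ => opNorm (C.ip (C.vecSemigroup (2 / ((n : ℝ) + 1)) t ξ - ξ)
        (C.vecSemigroup (2 / ((n : ℝ) + 1)) t ξ - ξ)) := by
      unfold opNorm
      refine continuous_norm.comp ?_
      have hl : Continuous (Matrix.toEuclideanCLM (n := Fin n) (𝕜 := ℂ)) :=
        LinearMap.continuous_of_finiteDimensional
          ((Matrix.toEuclideanCLM (n := Fin n) (𝕜 := ℂ)).toAlgEquiv.toLinearMap)
      refine hl.comp ?_
      simp only [h, map_add, LinearMap.add_apply, map_smulₛₗ, LinearMap.smul_apply,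
        RingHom.id_apply, map_sub, map_mul, map_one, Complex.conj_ofReal]
      fun_prop
    have := (hc.tendsto 0).mono_left (nhdsWithin_le_nhds (s := Set.Ici 0))
    simpa [vecSemigroup_apply, opNorm] using this
  · intro t _ A
    rw [vecSemigroup_apply, C.proj_d hn, sub_self, smul_zero, add_zero, C.d_depolarizing]
  · intro t _ ξ
    simp only [vecSemigroup_apply, map_smulₛₗ, map_add, map_sub, C.J_proj hn, Complex.conj_ofReal]
  · intro s t _ ξ
    rw [C.V_eq_id]; rfl
  · intro t ht ξ
    exact C.vecSemigroup_estimate hn ht ξ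

/-- On `d A` the intertwining relation leaves no freedom in `Q_t`. For `A = e_ij` with `i ≠ j` the
diagonal entry at `j` saturates `smul_ip_d_le`, so that entry of the estimate already bounds `K`. -/
theorem le_of_intertwiningCurvatureGE (hn : 2 ≤ n) {K : ℝ} (hK : C.IntertwiningCurvatureGE K) :
    K ≤ 1 / 2 + 1 / ((n : ℝ) + 1) := by
  obtain ⟨Q, -, -, -, hQ, -, -, hle⟩ := hK
  let i : Fin n := ⟨0, by omega⟩
  let j : Fin n := ⟨1, by omega⟩
  have hij : i ≠ j := by simp [i, j]
  have hn0 : (n : ℝ) ≠ 0 := by positivity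
  set A : Mat n := Matrix.single i j 1 with hA
  have hτA : tau A = 0 := by
    rw [tau, Matrix.trace_single_eq_of_ne _ _ _ hij, mul_zero]
  have hAA : A.conjTranspose * A = Matrix.single j j 1 := by
    rw [hA, Matrix.conjTranspose_single]; simp
  have hτAA : tau (A.conjTranspose * A) = ((n : ℝ)⁻¹ : ℝ) := by
    rw [hAA, tau, Matrix.trace_single_eq_same]; simp
  have hΓ : C.ip (C.d A) (C.d A) j j = ((1 / 2 * (1 + (n : ℝ)⁻¹) : ℝ) : ℂ) := by
    rw [C.ip_d_d, hτA, hτAA, hAA]; simp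
  have hτΓ : tau (C.ip (C.d A) (C.d A)) = ((n : ℝ)⁻¹ : ℝ) := by
    rw [C.tau_ip_d_d (by omega), hτA, hτAA]; simp
  set g : ℝ := 1 / 2 * (1 + (n : ℝ)⁻¹) with hg
  have hineq : ∀ t : ℝ, 0 ≤ t → 0 ≤ Real.exp (-2 * K * t) * (Real.exp (-t) * g +
      (1 - Real.exp (-t)) * (n : ℝ)⁻¹) - Real.exp (-t) * (Real.exp (-t) * g) := by
    intro t ht
    have h1 := (hle t ht (C.d A)).diag_nonneg (i := j)
    rw [hQ t ht, C.d_depolarizing] at h1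
    simp only [map_smulₛₗ, LinearMap.smul_apply, RingHom.id_apply, Complex.conj_ofReal,
      Matrix.sub_apply, Matrix.smul_apply, smul_eq_mul, depolarizing_apply, Matrix.add_apply,
      hΓ, hτΓ, Matrix.one_apply_eq, mul_one] at h1
    exact_mod_cast h1
  have hder : HasDerivAt (fun t : ℝ => Real.exp (-2 * K * t) * (Real.exp (-t) * g +
      (1 - Real.exp (-t)) * (n : ℝ)⁻¹) - Real.exp (-t) * (Real.exp (-t) * g))
      ((-2 * K) * g + (-g + (n : ℝ)⁻¹) - (-g + -g)) 0 := by
    have e1 : HasDerivAt (fun t : ℝ => Real.exp (-2 * K * t)) (-2 * K) 0 := by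
      simpa using ((hasDerivAt_id (0 : ℝ)).const_mul (-2 * K)).exp
    have e2 : HasDerivAt (fun t : ℝ => Real.exp (-t)) (-1) 0 := by
      simpa using (hasDerivAt_neg (0 : ℝ)).exp
    refine HasDerivAt.congr_deriv ((e1.mul ((e2.mul_const g).add
      ((e2.const_sub 1).mul_const (n : ℝ)⁻¹))).sub (e2.mul (e2.mul_const g))) ?_
    simp
  -- The function in `hineq` is nonnegative for `t ≥ 0` and vanishes at `0`, so its derivative there
  -- is nonnegative.
  have hpos : 0 ≤ (-2 * K) * g + (-g + (n : ℝ)⁻¹) - (-g + -g) := by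
    have hs := hder.tendsto_slope_zero_right
    refine ge_of_tendsto hs ?_
    filter_upwards [self_mem_nhdsWithin] with t ht
    have ht' : (0 : ℝ) < t := ht
    have := hineq t ht'.le
    refine smul_nonneg (by positivity) ?_
    simpa using this
  have hg' : 0 < g := by positivity
  have hng : (n : ℝ)⁻¹ = 2 / ((n : ℝ) + 1) * g := by rw [hg]; field_simp
  rw [hng] at hpos
  have : 0 ≤ g * (2 * (1 / 2 + 1 / ((n : ℝ) + 1) - K)) := by
    have e : g * (2 * (1 / 2 + 1 / ((n : ℝ) + 1) - K)) =
      (-2 * K) * g + (-g + 2 / ((n : ℝ) + 1) * g) - (-g + -g) := by ring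
    rw [e]; exact hpos
  have := nonneg_of_mul_nonneg_right this hg'
  linarith

end FirstOrderCalculus

/-! ### Operator means -/

theorem conjDiag_posDef {n : ℕ} {U : Mat n} (hU : U ∈ Matrix.unitaryGroup (Fin n) ℂ)
    {l : Fin n → ℝ} (hl : ∀ i, 0 < l i) : (conjDiag U l).PosDef := by
  have hu : IsUnit U := by
    rw [Matrix.isUnit_iff_isUnit_det]
    exact Matrix.isUnit_det_of_right_inverse (mul_conjTranspose_self_of_mem_unitaryGroup hU)
  refine Matrix.PosDef.mul_mul_conjTranspose_same (Matrix.PosDef.diagonal fun i => ?_)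
    (Matrix.vecMul_injective_of_isUnit hu)
  simpa using hl i

/-- Rotate `diag(a,b)` by a 2×2 reflection with entries `√θ, √φ`: its corner entry becomes `θa +
φb`, and applying `h` gives the corner entry `θh(a) + φh(b)`. Dominating the rotated matrix by a
diagonal one with corner `θa + φb + ε` and using monotonicity gives concavity up to `ε`; continuity
removes it. -/
theorem IsOperatorMonotone.concaveOn {h : ℝ → ℝ} (hm : IsOperatorMonotone h)
    (hc : ContinuousOn h (Set.Ioi 0)) : ConcaveOn ℝ (Set.Ioi 0) h := by
  refine ⟨convex_Ioi 0, fun a ha b hb θ φ hθ hφ hθφ => ?_⟩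
  simp only [smul_eq_mul]
  have ha' : 0 < a := ha
  have hb' : 0 < b := hb
  have hc0 : 0 < θ * a + φ * b := (convex_Ioi (0 : ℝ)) ha hb hθ hφ hθφ
  have hd0 : 0 < φ * a + θ * b := (convex_Ioi (0 : ℝ)) ha hb hφ hθ (by rw [add_comm, hθφ])
  have hsθ := Real.mul_self_sqrt hθ
  have hsφ := Real.mul_self_sqrt hφ
  set p := Real.sqrt θ
  set q := Real.sqrt φ
  have key : ∀ ε : ℝ, 0 < ε → θ * h a + φ * h b ≤ h (θ * a + φ * b + ε) := by
    intro ε hε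
    set x := p * q * (a - b) with hx
    let U : Mat 2 := !![(p : ℂ), (q : ℂ); (q : ℂ), -(p : ℂ)]
    have hUH : U.conjTranspose = U := by
      ext i j
      fin_cases i <;> fin_cases j <;> simp [U]
    have hU : U ∈ Matrix.unitaryGroup (Fin 2) ℂ := by
      rw [Matrix.mem_unitaryGroup_iff, Matrix.star_eq_conjTranspose, hUH]
      have h1 : (p : ℂ) * p + q * q = 1 := by
        exact_mod_cast (by rw [hsθ, hsφ, hθφ] : p * p + q * q = 1)
      ext i j
      fin_cases i <;> fin_cases j <;> simp [U, Matrix.mul_apply, Fin.sum_univ_two]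
      · exact h1
      · ring
      · ring
      · rw [add_comm]; exact h1
    have hone : (1 : Mat 2) ∈ Matrix.unitaryGroup (Fin 2) ℂ := one_mem _
    have hentry : ∀ l : Fin 2 → ℝ, conjDiag U l = !![((θ * l 0 + φ * l 1 : ℝ) : ℂ),
        ((p * q * (l 0 - l 1) : ℝ) : ℂ); ((p * q * (l 0 - l 1) : ℝ) : ℂ),
        ((φ * l 0 + θ * l 1 : ℝ) : ℂ)] := by
      intro l
      rw [← hsθ, ← hsφ]
      ext i j
      rw [conjDiag_apply, Fin.sum_univ_two]
      fin_cases i <;> fin_cases j <;> simp [U] <;> ring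
    have hle : LoewnerLE (conjDiag U ![a, b])
        (conjDiag 1 ![θ * a + φ * b + ε, φ * a + θ * b + x ^ 2 / ε]) := by
      -- The second diagonal entry is raised by `x²/ε`, which makes the difference from the rotated
      -- matrix, with off-diagonal entry `x`, a nonnegative rank-one matrix.
      have e : conjDiag 1 ![θ * a + φ * b + ε, φ * a + θ * b + x ^ 2 / ε] - conjDiag U ![a, b] =
          (1 / ε) • Matrix.vecMulVec ![(ε : ℂ), -(x : ℂ)] (star ![(ε : ℂ), -(x : ℂ)]) := by
        have hε' : (ε : ℂ) ≠ 0 := by exact_mod_cast hε.ne'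
        rw [hentry, ← Complex.coe_smul]
        ext i j
        rw [Matrix.sub_apply, Matrix.smul_apply, Matrix.vecMulVec_apply, conjDiag_apply,
          Fin.sum_univ_two]
        fin_cases i <;> fin_cases j <;> simp [hx, Matrix.one_apply] <;> field_simp
      rw [LoewnerLE, e]
      exact (Matrix.posSemidef_vecMulVec_self_star _).smul (by positivity)
    have hres := hm 2 _ _ (conjDiag_posDef hone (fun i => ?_)) (conjDiag_posDef hU (fun i => ?_)) hle
    · rw [cfc_conjDiag hone, cfc_conjDiag hU] at hres
      have h00 := Matrix.PosSemidef.diag_nonneg hres (i := 0)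
      rw [hentry] at h00
      simp [conjDiag] at h00
      exact_mod_cast h00
    · fin_cases i
      · simp; positivity
      · simp; positivity
    · fin_cases i
      · simpa using ha'
      · simpa using hb'
  have hlim : Filter.Tendsto (fun ε : ℝ => h (θ * a + φ * b + ε)) (nhdsWithin 0 (Set.Ioi 0))
      (nhds (h (θ * a + φ * b))) := by
    have h1 : ContinuousAt h (θ * a + φ * b + 0) := by
      rw [add_zero]; exact hc.continuousAt (Ioi_mem_nhds hc0)
    have h2 : ContinuousAt (fun ε : ℝ => θ * a + φ * b + ε) 0 := by fun_prop
    have h3 : ContinuousAt (fun ε : ℝ => h (θ * a + φ * b + ε)) 0 :=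
      ContinuousAt.comp (g := h) h1 h2
    have h4 := h3.tendsto.mono_left (nhdsWithin_le_nhds (s := Set.Ioi (0 : ℝ)))
    simpa using h4
  refine ge_of_tendsto hlim ?_
  filter_upwards [self_mem_nhdsWithin] with ε hε using key ε hε

/-! ### Scalar inequalities for operator means. -/

namespace IsOperatorMean

variable {Λ : ℝ → ℝ → ℝ}

theorem exists_concaveOn (hΛ : IsOperatorMean Λ) : ∃ h : ℝ → ℝ, ConcaveOn ℝ (Set.Ioi 0) h ∧
    h 1 = 1 ∧ ∀ s t : ℝ, 0 < s → 0 < t → Λ s t = s * h (t / s) := by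
  obtain ⟨h, -, hm, h1, heq⟩ := hΛ.exists_monotone
  refine ⟨h, hm.concaveOn ?_, h1, heq⟩
  have hc : ContinuousOn (fun t : ℝ => Λ 1 t) (Set.Ioi 0) :=
    hΛ.continuousOn.comp (f := fun t : ℝ => ((1 : ℝ), t)) (by fun_prop)
      fun t ht => ⟨zero_le_one' ℝ, le_of_lt (Set.mem_Ioi.mp ht)⟩
  refine hc.congr fun t ht => ?_
  simpa using (heq 1 t one_pos ht).symm

theorem self (hΛ : IsOperatorMean Λ) {s : ℝ} (hs : 0 < s) : Λ s s = s := by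
  obtain ⟨h, -, h1, heq⟩ := hΛ.exists_concaveOn
  rw [heq s s hs hs, div_self hs.ne', h1, mul_one]

theorem one_left_mul (hΛ : IsOperatorMean Λ) {s t : ℝ} (hs : 0 < s) (ht : 0 < t) :
    s * Λ 1 (t / s) = Λ s t := by
  obtain ⟨h, -, h1, heq⟩ := hΛ.exists_concaveOn
  rw [heq s t hs ht, heq 1 (t / s) one_pos (by positivity), one_mul, div_one]

/-- Jensen for `h` at `t/s` and `s/t` with weights `s/(s+t)` and `t/(s+t)`: the barycentre is `1`,
where `h = 1`. -/
theorem add_swap_le (hΛ : IsOperatorMean Λ) {s t : ℝ} (hs : 0 < s) (ht : 0 < t) :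
    Λ s t + Λ t s ≤ s + t := by
  obtain ⟨h, hc, h1, heq⟩ := hΛ.exists_concaveOn
  have := hc.2 (Set.mem_Ioi.mpr (div_pos ht hs)) (Set.mem_Ioi.mpr (div_pos hs ht))
    (show 0 ≤ s / (s + t) by positivity) (show 0 ≤ t / (s + t) by positivity) (by field_simp)
  simp only [smul_eq_mul] at this
  have e : s / (s + t) * (t / s) + t / (s + t) * (s / t) = 1 := by field_simp; ring
  rw [e, h1] at this
  rw [heq s t hs ht, heq t s ht hs]
  have e2 : s / (s + t) * h (t / s) + t / (s + t) * h (s / t) =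
      (s * h (t / s) + t * h (s / t)) / (s + t) := by ring
  rwa [e2, div_le_one (by positivity)] at this

/-- A homogeneous function with concave profile is superadditive; here `(us, ut)` is added to `(vm,
vm)`, on which `Λ` equals `vm`. -/
theorem add_le (hΛ : IsOperatorMean Λ) {s t m u v : ℝ} (hs : 0 < s) (ht : 0 < t) (hm : 0 < m)
    (hu : 0 < u) (hv : 0 ≤ v) :
    u * Λ s t + v * m ≤ Λ (u * s + v * m) (u * t + v * m) := by
  obtain ⟨h, hc, h1, heq⟩ := hΛ.exists_concaveOn
  have hS : 0 < u * s + v * m := by positivity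
  have := hc.2 (Set.mem_Ioi.mpr (div_pos ht hs)) (Set.mem_Ioi.mpr one_pos)
    (show 0 ≤ u * s / (u * s + v * m) by positivity)
    (show 0 ≤ v * m / (u * s + v * m) by positivity) (by field_simp)
  simp only [smul_eq_mul] at this
  have e : u * s / (u * s + v * m) * (t / s) + v * m / (u * s + v * m) * 1 =
      (u * t + v * m) / (u * s + v * m) := by field_simp
  rw [e, h1, mul_one] at this
  rw [heq s t hs ht, heq _ _ hS (by positivity)]
  have h2 := mul_le_mul_of_nonneg_left this hS.le
  refine le_trans (le_of_eq ?_) h2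
  field_simp

end IsOperatorMean

/-- Convexity of the exponential function in the form used for the gradient estimate. -/
theorem exp_neg_le_convex_comb {n : ℝ} (hn : 2 ≤ n) (t : ℝ) :
    Real.exp (-(1 - 2 / n) * t) ≤ Real.exp (-t) + (1 - Real.exp (-t)) * (2 / n) := by
  have h0 : 0 ≤ 2 / n := by positivity
  have h1 : 2 / n ≤ 1 := by rw [div_le_one (by linarith)]; exact hn
  have := convexOn_exp.2 (Set.mem_univ (-t)) (Set.mem_univ 0) (sub_nonneg.mpr h1) h0 (by ring)
  simp only [smul_eq_mul, mul_zero, add_zero, Real.exp_zero, mul_one] at this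
  rw [show -(1 - 2 / n) * t = (1 - 2 / n) * -t by ring]
  linarith

theorem exp_mul_le_of_le {n X m t : ℝ} (hn : 2 ≤ n) (ht : 0 ≤ t) (hX : 0 ≤ X) (hXm : X ≤ n * m) :
    Real.exp (-(1 - 2 / n) * t) * X ≤ Real.exp (-t) * X + (1 - Real.exp (-t)) * (2 * m) := by
  have h1 := mul_le_mul_of_nonneg_right (exp_neg_le_convex_comb hn t) hX
  have hu : 0 ≤ 1 - Real.exp (-t) := by
    have : Real.exp (-t) ≤ 1 := Real.exp_le_one_iff.mpr (by linarith)
    linarith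
  have h2 : 2 / n * X ≤ 2 * m := by
    have h3 := mul_le_mul_of_nonneg_left hXm (by positivity : 0 ≤ 2 / n)
    refine h3.trans (le_of_eq ?_)
    field_simp
  have h4 := mul_le_mul_of_nonneg_left h2 hu
  nlinarith

/-- By `add_le` the right side is at least `uX + 2(1-u)m`, where `X` is the symmetrized mean on the
left and `u = e^{-t}`. Since `X ≤ s + r ≤ nm`, the second term is at least `(1-u)(2/n)X`, and
convexity of `exp` finishes. -/
theorem IsOperatorMean.exp_mul_add_swap_le {Λ : ℝ → ℝ → ℝ} (hΛ : IsOperatorMean Λ)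
    {n s r m t : ℝ} (hn : 2 ≤ n) (hs : 0 < s) (hr : 0 < r) (hm : s + r ≤ n * m) (ht : 0 ≤ t) :
    Real.exp (-(1 - 2 / n) * t) * (Λ s r + Λ r s) ≤
      Λ (Real.exp (-t) * s + (1 - Real.exp (-t)) * m)
          (Real.exp (-t) * r + (1 - Real.exp (-t)) * m) +
        Λ (Real.exp (-t) * r + (1 - Real.exp (-t)) * m)
          (Real.exp (-t) * s + (1 - Real.exp (-t)) * m) := by
  have hm0 : 0 < m := pos_of_mul_pos_right (lt_of_lt_of_le (by linarith) hm) (by linarith : 0 ≤ n)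
  have hu : 0 ≤ 1 - Real.exp (-t) := by
    have : Real.exp (-t) ≤ 1 := Real.exp_le_one_iff.mpr (by linarith)
    linarith
  have h1 := hΛ.add_le hs hr hm0 (Real.exp_pos (-t)) hu
  have h2 := hΛ.add_le hr hs hm0 (Real.exp_pos (-t)) hu
  have h3 := exp_mul_le_of_le (X := Λ s r + Λ r s) hn ht
    (add_nonneg (hΛ.nonneg _ _ hs.le hr.le) (hΛ.nonneg _ _ hr.le hs.le))
    ((hΛ.add_swap_le hs hr).trans hm)
  linarith

/-- In the application a single `g k k` can be negative, so summands cannot be signed one by one.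
Separating `b k k = a k ^ 2` completes the square `(a k - a l)^2`; each off-diagonal `b k m` is then
multiplied by a sum of two row totals `S k + S m`, in which diagonal coefficients of `g` occur as
the pair `g k k + g m m`. -/
theorem sum_weight_nonneg {ι : Type*} [Fintype ι] [DecidableEq ι] (g : ι → ι → ℝ) (a : ι → ℝ)
    (b : ι → ι → ℝ) (hb : ∀ k m, 0 ≤ b k m) (hbs : ∀ k m, b k m = b m k)
    (hbd : ∀ k, b k k = a k ^ 2) (hg : ∀ k l, k ≠ l → 0 ≤ g k l + g l k)
    (hgd : ∀ k l, k ≠ l → 0 ≤ g k k + g l l) :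
    0 ≤ ∑ k, ∑ l, g k l * ((∑ m, b k m) + (∑ m, b l m) - 2 * a k * a l) := by
  set S : ι → ℝ := fun k => ∑ l, (g k l + g l k) with hS
  have hSS : ∀ k m, k ≠ m → 0 ≤ S k + S m := by
    intro k m hkm
    have h1 : ∀ k, S k = 2 * g k k + ∑ l ∈ Finset.univ.erase k, (g k l + g l k) := by
      intro k
      rw [hS]
      simp only
      rw [← Finset.add_sum_erase _ _ (Finset.mem_univ k)]
      ring
    have h2 : ∀ k, 0 ≤ ∑ l ∈ Finset.univ.erase k, (g k l + g l k) := fun k =>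
      Finset.sum_nonneg fun l hl => hg k l (Finset.ne_of_mem_erase hl).symm
    rw [h1, h1]
    have := hgd k m hkm
    linarith [h2 k, h2 m]
  set b' : ι → ι → ℝ := fun k m => if k = m then 0 else b k m with hb'
  have hrow : ∀ k, ∑ m, b k m = a k ^ 2 + ∑ m, b' k m := by
    intro k
    rw [← Finset.add_sum_erase _ (b k) (Finset.mem_univ k), hbd,
      ← Finset.add_sum_erase _ (b' k) (Finset.mem_univ k)]
    simp only [hb', if_true, zero_add]
    congr 1
    exact Finset.sum_congr rfl fun m hm => (if_neg (Finset.ne_of_mem_erase hm).symm).symm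
  have hsplit : 2 * ∑ k, ∑ l, g k l * ((∑ m, b k m) + (∑ m, b l m) - 2 * a k * a l) =
      (∑ k, ∑ l, (g k l + g l k) * (a k - a l) ^ 2) + ∑ k, ∑ m, b' k m * (S k + S m) := by
    have hsw : ∀ f : ι → ι → ℝ, ∑ k, ∑ l, f k l = ∑ k, ∑ l, f l k := fun f => Finset.sum_comm
    have e1 : ∑ k, ∑ l, (g k l + g l k) * (a k - a l) ^ 2 =
        2 * ∑ k, ∑ l, g k l * (a k - a l) ^ 2 := by
      simp only [add_mul, Finset.sum_add_distrib]
      rw [hsw (fun k l => g l k * (a k - a l) ^ 2), two_mul]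
      congr 1
      exact Finset.sum_congr rfl fun k _ => Finset.sum_congr rfl fun l _ => by ring
    have e2 : ∑ k, ∑ m, b' k m * (S k + S m) = 2 * ∑ k, (∑ m, b' k m) * S k := by
      simp only [mul_add, Finset.sum_add_distrib]
      rw [hsw (fun k m => b' k m * S m), two_mul]
      have hbs' : ∀ k m, b' k m = b' m k := by
        intro k m
        simp only [hb', hbs k m, eq_comm]
      simp only [Finset.sum_mul]
      congr 1
      exact Finset.sum_congr rfl fun k _ => Finset.sum_congr rfl fun l _ => by rw [hbs']
    have e3 : ∑ k, (∑ m, b' k m) * S k =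
        ∑ k, ∑ l, g k l * ((∑ m, b' k m) + ∑ m, b' l m) := by
      simp only [hS, mul_add, Finset.sum_add_distrib, Finset.mul_sum]
      congr 1
      · exact Finset.sum_congr rfl fun k _ => Finset.sum_congr rfl fun l _ => by
          rw [← Finset.mul_sum]; ring
      · rw [hsw]
        exact Finset.sum_congr rfl fun k _ => Finset.sum_congr rfl fun l _ => by
          rw [← Finset.mul_sum]; ring
    rw [e1, e2, e3, ← mul_add, ← Finset.sum_add_distrib]
    congr 1
    refine Finset.sum_congr rfl fun k _ => ?_
    rw [← Finset.sum_add_distrib]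
    refine Finset.sum_congr rfl fun l _ => ?_
    rw [hrow, hrow]
    ring
  have hn1 : 0 ≤ ∑ k, ∑ l, (g k l + g l k) * (a k - a l) ^ 2 := by
    refine Finset.sum_nonneg fun k _ => Finset.sum_nonneg fun l _ => ?_
    by_cases hkl : k = l
    · subst hkl; simp
    · exact mul_nonneg (hg k l hkl) (sq_nonneg _)
  have hn2 : 0 ≤ ∑ k, ∑ m, b' k m * (S k + S m) := by
    refine Finset.sum_nonneg fun k _ => Finset.sum_nonneg fun m _ => ?_
    by_cases hkm : k = m
    · subst hkm; simp [hb']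
    · simp only [hb', if_neg hkm]
      exact mul_nonneg (hb k m) (hSS k m hkm)
  linarith

/-! ### The gradient estimate -/

namespace FirstOrderCalculus

variable {n : ℕ} (C : FirstOrderCalculus.{u} (1 : Mat n) (depolarizing n))

/-- The extension is obtained by choice, so only its defining property is usable: each `φ (V_z ξ)`
is entire and constant on real `z`, hence constant by the identity theorem. -/
theorem Vext_eq_id (z : ℂ) : C.Vext z = LinearMap.id := by
  have hex : ∃ W, C.IsAnalyticExtension W :=
    ⟨fun _ => LinearMap.id, fun t => (C.V_eq_id t).symm, fun ξ φ => by simp⟩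
  have hV : C.IsAnalyticExtension C.Vext := by
    rw [Vext, dif_pos hex]; exact hex.choose_spec
  refine LinearMap.ext fun ξ => ?_
  rw [← sub_eq_zero, ← Module.forall_dual_apply_eq_zero_iff ℂ]
  intro φ
  have hd : Differentiable ℂ fun z => φ (C.Vext z ξ) := hV.2 ξ φ
  have ha : AnalyticOnNhd ℂ (fun z => φ (C.Vext z ξ)) Set.univ := fun w _ => hd.analyticAt w
  have hc : AnalyticOnNhd ℂ (fun _ : ℂ => φ ξ) Set.univ := analyticOnNhd_const
  have heq := ha.eq_of_frequently_eq (z₀ := 0) hc ?_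
  · have := congrFun heq z
    rw [map_sub, LinearMap.id_apply, this, sub_self]
  · have htend : Filter.Tendsto (fun t : ℝ => (t : ℂ)) (nhdsWithin 0 (Set.Ioi 0))
        (nhdsWithin 0 {0}ᶜ) := by
      refine tendsto_nhdsWithin_iff.mpr ⟨?_, ?_⟩
      · have := (Complex.continuous_ofReal.tendsto 0).mono_left
          (nhdsWithin_le_nhds (s := Set.Ioi (0 : ℝ)))
        simpa using this
      · filter_upwards [self_mem_nhdsWithin] with t ht
        simpa using (ne_of_gt (Set.mem_Ioi.mp ht))
    refine htend.frequently (Filter.Eventually.frequently (Filter.Eventually.of_forall fun t => ?_))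
    rw [hV.1 t, C.V_eq_id]; rfl

theorem Vrho_neg_I (ρ : Mat n) :
    C.Vrho ρ (-Complex.I) = C.mulBoth (mpow ρ (1 : ℝ)) (mpow ρ (-1 : ℝ)) := by
  have h : Complex.I * -Complex.I = 1 := by rw [mul_neg, Complex.I_mul_I, neg_neg]
  rw [Vrho, C.Vext_eq_id, LinearMap.comp_id, mpow_one_left, mpow_one_left, one_mul, mul_one, h]
  simp

variable {U : Mat n} {l : Fin n → ℝ}

theorem Vrho_colProj (hU : U ∈ Matrix.unitaryGroup (Fin n) ℂ) (hl : ∀ i, 0 < l i) (ξ : C.F)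
    (k m : Fin n) : C.Vrho (conjDiag U l) (-Complex.I) ((colProj U k •> ξ) <• colProj U m) =
      ((l k / l m : ℝ) : ℂ) • ((colProj U k •> ξ) <• colProj U m) := by
  rw [C.Vrho_neg_I, mpow_conjDiag hU, mpow_conjDiag hU]
  change (conjDiag U _ •> ((colProj U k •> ξ) <• colProj U m)) <• conjDiag U _ = _
  rw [smul_comm (conjDiag U _) (MulOpposite.op (colProj U m)), smul_smul, smul_smul,
    ← MulOpposite.op_mul, conjDiag_mul_colProj hU, colProj_mul_conjDiag hU, MulOpposite.op_smul,
    smul_assoc, smul_assoc, smul_comm (MulOpposite.op (colProj U m)), smul_smul]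
  congr 1
  rw [one_mul, neg_one_mul, Real.exp_neg, Real.exp_log (hl k), Real.exp_log (hl m)]
  push_cast
  rw [div_eq_mul_inv, mul_comm]

theorem sum_colProj_smul (hU : U ∈ Matrix.unitaryGroup (Fin n) ℂ) (ξ : C.F) :
    ∑ k, ∑ m, (colProj U k •> ξ) <• colProj U m = ξ := by
  have h1 : ∀ η : C.F, ∑ m, η <• colProj U m = η := by
    intro η
    rw [← Finset.sum_smul, ← Finset.op_sum, sum_colProj hU, MulOpposite.op_one, one_smul]
  simp only [h1, ← Finset.sum_smul, sum_colProj hU, one_smul]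

/-- The blocks `p_k ξ p_m` are eigenvectors of `V^ρ_{-i}` for `l_k / l_m`. The factor `l_m` supplied
by `ρ` turns `Λ(1, l_k / l_m)` into `Λ(l_m, l_k)` by homogeneity. -/
theorem normSqMean_conjDiag {Λ : ℝ → ℝ → ℝ} (hΛ : IsOperatorMean Λ)
    (hU : U ∈ Matrix.unitaryGroup (Fin n) ℂ) (hl : ∀ i, 0 < l i) (ξ : C.F) :
    C.normSqMean Λ (conjDiag U l) ξ = ∑ k, ∑ m, Λ (l m) (l k) *
      (tau (C.ip (colProj U k •> ξ) ξ * colProj U m)).re := by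
  have h1 : funCalc (fun t => Λ 1 t) (C.Vrho (conjDiag U l) (-Complex.I)) ξ =
      ∑ k, ∑ m, (Λ 1 (l k / l m) : ℂ) • ((colProj U k •> ξ) <• colProj U m) := by
    conv_lhs => rw [← C.sum_colProj_smul hU ξ]
    simp only [map_sum]
    exact Finset.sum_congr rfl fun k _ => Finset.sum_congr rfl fun m _ =>
      funCalc_apply_eigenvector _ _ _ _ (C.Vrho_colProj hU hl ξ k m)
  rw [normSqMean, innerMean, h1]
  simp only [map_sum, Finset.sum_mul, tau_sum, Complex.re_sum]
  refine Finset.sum_congr rfl fun k _ => Finset.sum_congr rfl fun m _ => ?_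
  rw [map_smul, C.ip_op_smul_right, C.ip_smul_right, colProj_conjTranspose, Matrix.smul_mul,
    Matrix.mul_assoc, colProj_mul_conjDiag hU, Matrix.mul_smul, smul_smul, tau_smul,
    ← Complex.ofReal_mul, Complex.re_ofReal_mul, ← hΛ.one_left_mul (hl m) (hl k)]
  ring

/-- The Leibniz rule writes `p_k •> d A` as `d (p_k A) - d p_k <• A`, so only the carré du champ
enters. The terms containing `τ(A)` and the fourfold product `A p_k A p_m` occur in both pieces and
cancel. -/
theorem tau_ip_colProj_smul_d (hU : U ∈ Matrix.unitaryGroup (Fin n) ℂ) {A : Mat n}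
    (hA : A.IsHermitian) (k m : Fin n) :
    (tau (C.ip (colProj U k •> C.d A) (C.d A) * colProj U m)).re = 1 / (2 * (n : ℝ) ^ 2) *
      ((∑ j, Complex.normSq ((U.conjTranspose * A * U) k j)) +
        (∑ j, Complex.normSq ((U.conjTranspose * A * U) m j)) -
        2 * ((U.conjTranspose * A * U) k k).re * ((U.conjTranspose * A * U) m m).re) := by
  set B := U.conjTranspose * A * U with hB
  have hBH : B.IsHermitian := by
    rw [Matrix.IsHermitian, hB, Matrix.conjTranspose_mul, Matrix.conjTranspose_mul,
      Matrix.conjTranspose_conjTranspose, hA.eq, Matrix.mul_assoc]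
  have hBsq : ∀ k, (U.conjTranspose * (A * A) * U) k k =
      ((∑ j, Complex.normSq (B k j) : ℝ) : ℂ) := by
    intro k
    have h1 : U.conjTranspose * (A * A) * U = B * B := by
      have h := mul_conjTranspose_self_of_mem_unitaryGroup hU
      calc _ = U.conjTranspose * A * (U * U.conjTranspose) * A * U := by
            rw [h]; simp only [Matrix.mul_assoc, one_mul]
        _ = _ := by rw [hB]; simp only [Matrix.mul_assoc]
    rw [h1, Matrix.mul_apply]
    push_cast
    refine Finset.sum_congr rfl fun j _ => ?_
    rw [Complex.normSq_eq_conj_mul_self, mul_comm]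
    congr 1
    rw [← hBH.apply j k]; rfl
  have hBd : ∀ k, B k k = ((B k k).re : ℂ) := fun k =>
    (Complex.conj_eq_iff_re.mp (hBH.apply k k)).symm
  have hτ1 : ∀ k, tau (colProj U k) = (n : ℂ)⁻¹ := by
    intro k
    have := tau_colProj_mul (U := U) k 1
    rwa [mul_one, mul_one, conjTranspose_mul_self_of_mem_unitaryGroup hU, Matrix.one_apply_eq,
      mul_one] at this
  have hτA : ∀ k, tau (colProj U k * A) = (n : ℂ)⁻¹ * ((B k k).re : ℂ) := by
    intro k; rw [tau_colProj_mul, ← hB, ← hBd]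
  have hτAA : ∀ k, tau (colProj U k * (A * A)) =
      (n : ℂ)⁻¹ * ((∑ j, Complex.normSq (B k j) : ℝ) : ℂ) := by
    intro k; rw [tau_colProj_mul, hBsq]
  have key : tau (C.ip (colProj U k •> C.d A) (C.d A) * colProj U m) =
      1 / 2 * (tau (colProj U k * (A * A)) * tau (colProj U m) +
        tau (colProj U k) * tau (colProj U m * (A * A)) -
        2 * tau (colProj U k * A) * tau (colProj U m * A)) := by
    have hstar : star (tau (colProj U k * A)) = tau (colProj U k * A) := by
      rw [← tau_conjTranspose, Matrix.conjTranspose_mul, hA.eq, colProj_conjTranspose,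
        tau_mul_comm]
    have hstar1 : star (tau (colProj U k)) = tau (colProj U k) := by
      rw [← tau_conjTranspose, colProj_conjTranspose]
    have hcyc : tau (A * colProj U k * A) = tau (colProj U k * (A * A)) := by
      rw [Matrix.mul_assoc, tau_mul_comm, Matrix.mul_assoc]
    rw [C.smul_d, map_sub, LinearMap.sub_apply, C.ip_op_smul_left, C.ip_d_d, C.ip_d_d, hstar,
      hstar1, Matrix.conjTranspose_mul, hA.eq, colProj_conjTranspose, hcyc, sub_mul]
    have e1 : tau ((1 / 2 : ℂ) • (A * colProj U k * A - tau (colProj U k * A) • A -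
        tau A • (A * colProj U k) + tau (colProj U k * (A * A)) • (1 : Mat n)) * colProj U m) =
        1 / 2 * (tau (A * colProj U k * A * colProj U m) - tau (colProj U k * A) *
          tau (colProj U m * A) - tau A * tau (A * colProj U k * colProj U m) +
          tau (colProj U k * (A * A)) * tau (colProj U m)) := by
      simp only [Matrix.smul_mul, add_mul, sub_mul, tau_smul, tau_add, tau_sub, one_mul,
        tau_mul_comm A (colProj U m)]
    have e2 : tau (A * ((1 / 2 : ℂ) • (colProj U k * A - tau (colProj U k) • A -
        tau A • colProj U k + tau (colProj U k * A) • (1 : Mat n))) * colProj U m) =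
        1 / 2 * (tau (A * colProj U k * A * colProj U m) - tau (colProj U k) *
          tau (colProj U m * (A * A)) - tau A * tau (A * colProj U k * colProj U m) +
          tau (colProj U k * A) * tau (colProj U m * A)) := by
      simp only [Matrix.smul_mul, Matrix.mul_smul, mul_add, mul_sub, add_mul, sub_mul, tau_smul,
        tau_add, tau_sub, mul_one, tau_mul_comm A (colProj U m),
        tau_mul_comm (A * A) (colProj U m), ← Matrix.mul_assoc]
    rw [tau_sub, e1, e2]
    ring
  rw [key, hτ1, hτ1, hτA, hτA, hτAA, hτAA]
  have : 1 / 2 * ((n : ℂ)⁻¹ * ((∑ j, Complex.normSq (B k j) : ℝ) : ℂ) * (n : ℂ)⁻¹ +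
      (n : ℂ)⁻¹ * ((n : ℂ)⁻¹ * ((∑ j, Complex.normSq (B m j) : ℝ) : ℂ)) -
      2 * ((n : ℂ)⁻¹ * ((B k k).re : ℂ)) * ((n : ℂ)⁻¹ * ((B m m).re : ℂ))) =
      ((1 / (2 * (n : ℝ) ^ 2) * ((∑ j, Complex.normSq (B k j)) + (∑ j, Complex.normSq (B m j)) -
        2 * (B k k).re * (B m m).re) : ℝ) : ℂ) := by
    push_cast
    ring
  rw [this, Complex.ofReal_re]

theorem normSqMean_smul {σ : Mat n} {P : ℝ → Mat n →ₗ[ℂ] Mat n} (C : FirstOrderCalculus.{u} σ P)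
    (Λ : ℝ → ℝ → ℝ) (ρ : Mat n) (c : ℝ) (ξ : C.F) :
    C.normSqMean Λ ρ ((c : ℂ) • ξ) = c ^ 2 * C.normSqMean Λ ρ ξ := by
  simp only [normSqMean, innerMean, map_smulₛₗ, LinearMap.smul_apply, smul_smul, RingHom.id_apply,
    Matrix.smul_mul, tau_smul, Complex.conj_ofReal]
  rw [← Complex.ofReal_mul, Complex.re_ofReal_mul, sq]

theorem gradientEstimate {Λ : ℝ → ℝ → ℝ} (hΛ : IsOperatorMean Λ) :
    C.GradientEstimate Λ (1 / 2 + 1 / (n : ℝ)) := by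
  intro A ρ hA hρ t ht
  obtain ⟨U, hU, l, hl, rfl⟩ := exists_eq_conjDiag_of_posDef hρ
  rw [dagger_depolarizing, C.d_depolarizing, C.normSqMean_smul]
  set u := Real.exp (-t) with hu
  set m : ℝ := (n : ℝ)⁻¹ * ∑ i, l i with hm
  have hu0 : 0 < u := Real.exp_pos _
  have hu1 : u ≤ 1 := Real.exp_le_one_iff.mpr (by linarith)
  have hm0 : 0 ≤ m := mul_nonneg (by positivity) (Finset.sum_nonneg fun i _ => (hl i).le)
  obtain ⟨l', hl'e⟩ : ∃ l' : Fin n → ℝ, l' = fun i => u * l i + (1 - u) * m := ⟨_, rfl⟩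
  have hP : depolarizing n t (conjDiag U l) = conjDiag U l' := by
    rw [hl'e, conjDiag_add, conjDiag_smul, conjDiag_const hU, depolarizing_apply, tau,
      trace_conjDiag hU, hm, ← hu]
    push_cast
    rfl
  have hl' : ∀ i, 0 < l' i := fun i => by
    rw [hl'e]
    exact add_pos_of_pos_of_nonneg (mul_pos hu0 (hl i)) (mul_nonneg (by linarith) hm0)
  rw [hP, C.normSqMean_conjDiag hΛ hU hl, C.normSqMean_conjDiag hΛ hU hl']
  simp only [C.tau_ip_colProj_smul_d hU hA]
  set B := U.conjTranspose * A * U with hB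
  have hBH : B.IsHermitian := by
    rw [Matrix.IsHermitian, hB, Matrix.conjTranspose_mul, Matrix.conjTranspose_mul,
      Matrix.conjTranspose_conjTranspose, hA.eq, Matrix.mul_assoc]
  -- Two distinct indices force `n ≥ 2`, so `n = 1` needs no separate case: there the pairwise
  -- conditions are vacuous.
  have hpair : ∀ j k, j ≠ k → 2 ≤ (n : ℝ) ∧ l j + l k ≤ n * m := by
    intro j k hjk
    have hn2 : 2 ≤ n := by
      by_contra hlt
      have : Subsingleton (Fin n) := by
        rw [Fin.subsingleton_iff_le_one]; omega
      exact hjk (Subsingleton.elim j k)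
    have hn0 : (n : ℝ) ≠ 0 := by positivity
    refine ⟨by exact_mod_cast hn2, ?_⟩
    rw [hm, mul_inv_cancel_left₀ hn0, ← Finset.sum_pair hjk]
    exact Finset.sum_le_sum_of_subset_of_nonneg (Finset.subset_univ _) fun i _ _ => (hl i).le
  -- This is what remains of the factor `e^{-2t}` from `d (P_t A)` after dividing by `e^{-2Kt}` with
  -- `K = 1/2 + 1/n`.
  set e := Real.exp (-(1 - 2 / (n : ℝ)) * t) with he
  have hsum := sum_weight_nonneg
    (fun k j => Λ (l' j) (l' k) - e * Λ (l j) (l k))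
    (fun k => (B k k).re) (fun k j => Complex.normSq (B k j)) (fun k j => Complex.normSq_nonneg _)
    (fun k j => by rw [← hBH.apply k j]; exact (Complex.normSq_conj _))
    (fun k => by
      have h0 : (B k k).im = 0 := Complex.conj_eq_iff_im.mp (hBH.apply k k)
      rw [Complex.normSq_apply, h0]; ring)
    (fun j k hjk => by
      obtain ⟨hn2, hjkm⟩ := hpair j k hjk
      have := hΛ.exp_mul_add_swap_le hn2 (hl j) (hl k) hjkm ht
      simp only [hl'e]
      linarith)
    (fun j k hjk => by
      obtain ⟨hn2, hjkm⟩ := hpair j k hjk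
      have := exp_mul_le_of_le hn2 ht (add_pos (hl j) (hl k)).le hjkm
      rw [hΛ.self (hl j), hΛ.self (hl k), hΛ.self (hl' j), hΛ.self (hl' k), hl'e]
      linarith)
  simp only [sub_mul, Finset.sum_sub_distrib, mul_assoc, ← Finset.mul_sum] at hsum
  have hexp : u ^ 2 = Real.exp (-2 * (1 / 2 + 1 / (n : ℝ)) * t) * e := by
    rw [hu, he, ← Real.exp_add, sq, ← Real.exp_add]
    congr 1
    ring
  have hfac : ∀ w : Fin n → Fin n → ℝ, ∀ c : Fin n → Fin n → ℝ,
      ∑ k, ∑ j, w k j * (1 / (2 * (n : ℝ) ^ 2) * c k j) =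
        1 / (2 * (n : ℝ) ^ 2) * ∑ k, ∑ j, w k j * c k j := by
    intro w c
    simp only [Finset.mul_sum]
    exact Finset.sum_congr rfl fun k _ => Finset.sum_congr rfl fun j _ => by ring
  rw [hfac (fun k j => Λ (l j) (l k)),
    hfac (fun k j => Λ (l' j) (l' k)), hexp, mul_assoc]
  refine mul_le_mul_of_nonneg_left ?_ (Real.exp_pos _).le
  rw [mul_left_comm]
  refine mul_le_mul_of_nonneg_left ?_ (by positivity)
  simp only [mul_assoc]
  linarith

end FirstOrderCalculus

/-! ### The logarithmic mean -/

section LogMean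

open scoped Matrix.Norms.L2Operator MatrixOrder

theorem isOperatorMonotone_rpow {x : ℝ} (hx : x ∈ Set.Icc (0 : ℝ) 1) :
    IsOperatorMonotone (fun t => t ^ x) := by
  intro m A B hA hB hAB
  have hA0 : (0 : Mat m) ≤ A := Matrix.nonneg_iff_posSemidef.mpr hA.posSemidef
  have hB0 : (0 : Mat m) ≤ B := Matrix.nonneg_iff_posSemidef.mpr hB.posSemidef
  have h := CFC.rpow_le_rpow hx (Matrix.le_iff.mpr hAB)
  rw [CFC.rpow_eq_cfc_real, CFC.rpow_eq_cfc_real] at h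
  exact Matrix.le_iff.mp h

end LogMean

theorem dotProduct_conjDiag_mulVec {n : ℕ} (U : Mat n) (l : Fin n → ℝ) (v : Fin n → ℂ) :
    star v ⬝ᵥ (conjDiag U l).mulVec v =
      ((∑ k, l k * Complex.normSq (U.conjTranspose.mulVec v k) : ℝ) : ℂ) := by
  rw [conjDiag, ← Matrix.mulVec_mulVec, ← Matrix.mulVec_mulVec, Matrix.dotProduct_mulVec,
    show Matrix.vecMul (star v) U = star (U.conjTranspose.mulVec v) by
      rw [Matrix.star_mulVec, Matrix.conjTranspose_conjTranspose], dotProduct]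
  push_cast
  refine Finset.sum_congr rfl fun k _ => ?_
  rw [Matrix.mulVec_diagonal, Complex.normSq_eq_conj_mul_self, Pi.star_apply]
  change (starRingEnd ℂ) _ * _ = _
  ring

/-- In eigenbases of the two matrices, quadratic forms of the functional calculus are finite sums,
so they commute with the integral and the pointwise inequality integrates. -/
theorem isOperatorMonotone_integral {f : ℝ → ℝ → ℝ}
    (hf : ∀ x ∈ Set.Icc (0 : ℝ) 1, IsOperatorMonotone (f x))
    (hint : ∀ t, 0 < t → IntervalIntegrable (fun x => f x t) MeasureTheory.volume 0 1) :
    IsOperatorMonotone (fun t => ∫ x in (0 : ℝ)..1, f x t) := by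
  intro m A B hA hB hAB
  have hf' := fun x hx => hf x hx m A B hA hB hAB
  obtain ⟨U, hU, l, hl, rfl⟩ := exists_eq_conjDiag_of_posDef hA
  obtain ⟨V, hV, k, hk, rfl⟩ := exists_eq_conjDiag_of_posDef hB
  simp only [LoewnerLE, cfc_conjDiag hU, cfc_conjDiag hV] at hf' ⊢
  refine Matrix.PosSemidef.of_dotProduct_mulVec_nonneg
    ((conjDiag_isHermitian _).sub (conjDiag_isHermitian _)) fun v => ?_
  have hsub : ∀ a b : Fin m → ℝ, star v ⬝ᵥ (conjDiag U a - conjDiag V b).mulVec v =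
      (((∑ i, a i * Complex.normSq (U.conjTranspose.mulVec v i)) -
        ∑ i, b i * Complex.normSq (V.conjTranspose.mulVec v i) : ℝ) : ℂ) := by
    intro a b
    rw [Matrix.sub_mulVec, dotProduct_sub, dotProduct_conjDiag_mulVec,
      dotProduct_conjDiag_mulVec, Complex.ofReal_sub]
  rw [hsub]
  have hsum : ∀ (W : Mat m) (a : Fin m → ℝ), (∀ i, 0 < a i) →
      IntervalIntegrable (fun x => ∑ i, f x (a i) * Complex.normSq (W.conjTranspose.mulVec v i))
        MeasureTheory.volume 0 1 ∧
      ∑ i, (∫ x in (0 : ℝ)..1, f x (a i)) * Complex.normSq (W.conjTranspose.mulVec v i) =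
        ∫ x in (0 : ℝ)..1, ∑ i, f x (a i) * Complex.normSq (W.conjTranspose.mulVec v i) := by
    intro W a ha
    have hi := fun i => (hint (a i) (ha i)).mul_const (Complex.normSq (W.conjTranspose.mulVec v i))
    refine ⟨by simpa only [Finset.sum_fn] using IntervalIntegrable.sum Finset.univ fun i _ => hi i, ?_⟩
    rw [intervalIntegral.integral_finsetSum fun i _ => hi i]
    simp only [intervalIntegral.integral_mul_const]
  obtain ⟨hi1, hs1⟩ := hsum U l hl
  obtain ⟨hi2, hs2⟩ := hsum V k hk
  rw [hs1, hs2, ← intervalIntegral.integral_sub hi1 hi2]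
  have hnn : 0 ≤ ∫ x in (0 : ℝ)..1,
      ((∑ i, f x (l i) * Complex.normSq (U.conjTranspose.mulVec v i)) -
        ∑ i, f x (k i) * Complex.normSq (V.conjTranspose.mulVec v i)) := by
    refine intervalIntegral.integral_nonneg zero_le_one fun x hx => ?_
    have := (hf' x hx).dotProduct_mulVec_nonneg v
    rw [hsub] at this
    exact_mod_cast this
  exact_mod_cast hnn

/-- Averaging weighted geometric means gives operator monotonicity through Löwner–Heinz and
continuity through dominated convergence. -/
theorem logMean_eq_integral {s t : ℝ} (hs : 0 ≤ s) (ht : 0 ≤ t) :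
    logMean s t = ∫ x in (0 : ℝ)..1, s ^ (1 - x) * t ^ x := by
  -- Since `0 ^ 0 = 1`, the integrand may fail to vanish at an endpoint; only the open interval is
  -- compared.
  have hzero : s = 0 ∨ t = 0 → ∫ x in (0 : ℝ)..1, s ^ (1 - x) * t ^ x = 0 := by
    intro h
    rw [intervalIntegral.integral_congr_Ioo_of_le (g := fun _ => 0) zero_le_one]
    · simp
    · intro x hx
      rcases h with rfl | rfl
      · simp [Real.zero_rpow (sub_pos.mpr hx.2).ne']
      · simp [Real.zero_rpow hx.1.ne']
  rw [logMean]
  split_ifs with h1 h2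
  · subst h1
    rcases hs.eq_or_lt with h0 | h0
    · rw [hzero (Or.inl h0.symm), h0]
    · have : ∀ x : ℝ, s ^ (1 - x) * s ^ x = s := fun x => by
        rw [← Real.rpow_add h0]; simp
      simp [this]
  · exact (hzero h2).symm
  · push Not at h2
    have hs0 : 0 < s := lt_of_le_of_ne hs h2.1.symm
    have ht0 : 0 < t := lt_of_le_of_ne ht h2.2.symm
    set c := Real.log t - Real.log s with hc
    have hc0 : c ≠ 0 := by
      intro h
      exact h1 (Real.log_injOn_pos hs0 ht0 (sub_eq_zero.mp h).symm)
    have hfun : ∀ x : ℝ, s ^ (1 - x) * t ^ x = s * Real.exp (x * c) := by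
      intro x
      rw [Real.rpow_def_of_pos hs0, Real.rpow_def_of_pos ht0, ← Real.exp_add, hc]
      conv_rhs => rw [← Real.exp_log hs0, Real.log_exp, ← Real.exp_add]
      congr 1
      ring
    simp only [hfun]
    rw [intervalIntegral.integral_const_mul, intervalIntegral.integral_comp_mul_right _ hc0,
      integral_exp, zero_mul, one_mul, Real.exp_zero, hc, Real.exp_sub, Real.exp_log hs0,
      Real.exp_log ht0, smul_eq_mul, ← neg_sub (Real.log t) (Real.log s), ← hc]
    field_simp
    ring

theorem continuousOn_logMean :
    ContinuousOn (fun p : ℝ × ℝ => logMean p.1 p.2) (Set.Ici 0 ×ˢ Set.Ici 0) := by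
  have hcongr : Set.EqOn (fun p : ℝ × ℝ => logMean p.1 p.2)
      (fun p : ℝ × ℝ => ∫ x in (0 : ℝ)..1, p.1 ^ (1 - x) * p.2 ^ x) (Set.Ici 0 ×ˢ Set.Ici 0) :=
    fun p hp => logMean_eq_integral hp.1 hp.2
  refine ContinuousOn.congr (fun p₀ hp₀ => ?_) hcongr
  have hne1 : ∀ᵐ x : ℝ, x ≠ 1 := by
    simp [MeasureTheory.ae_iff]
  refine intervalIntegral.continuousWithinAt_of_dominated_interval
    (bound := fun _ => (p₀.1 + 2) * (p₀.2 + 2)) ?_ ?_ ?_ ?_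
  · exact Filter.Eventually.of_forall fun p => by
      refine Measurable.aestronglyMeasurable ?_
      fun_prop
  · have h1 : ∀ᶠ p : ℝ × ℝ in nhdsWithin p₀ (Set.Ici 0 ×ˢ Set.Ici 0), p.1 < p₀.1 + 1 :=
      nhdsWithin_le_nhds ((continuous_fst.tendsto p₀).eventually_lt_const (by linarith))
    have h2 : ∀ᶠ p : ℝ × ℝ in nhdsWithin p₀ (Set.Ici 0 ×ˢ Set.Ici 0), p.2 < p₀.2 + 1 :=
      nhdsWithin_le_nhds ((continuous_snd.tendsto p₀).eventually_lt_const (by linarith))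
    have hp₁ : 0 ≤ p₀.1 := hp₀.1
    have hp₂ : 0 ≤ p₀.2 := hp₀.2
    -- The base `b + 2` is at least `1`, so its exponent can be raised to `1`, giving a bound
    -- uniform in `x`.
    have hle : ∀ a b y : ℝ, 0 ≤ a → 0 ≤ b → a < b + 1 → y ∈ Set.Icc (0 : ℝ) 1 → a ^ y ≤ b + 2 := by
      intro a b y ha hb hab hy
      calc a ^ y ≤ (b + 2) ^ y := Real.rpow_le_rpow ha (by linarith) hy.1
        _ ≤ (b + 2) ^ (1 : ℝ) := Real.rpow_le_rpow_of_exponent_le (by linarith) hy.2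
        _ = b + 2 := Real.rpow_one _
    filter_upwards [h1, h2, self_mem_nhdsWithin] with p hp1 hp2 hp
    refine Filter.Eventually.of_forall fun x hx => ?_
    rw [Set.uIoc_of_le zero_le_one] at hx
    have ha : 0 ≤ p.1 := hp.1
    have hb : 0 ≤ p.2 := hp.2
    rw [Real.norm_of_nonneg (by positivity)]
    exact mul_le_mul (hle _ _ _ ha hp₁ hp1 ⟨by linarith [hx.2], by linarith [hx.1]⟩)
      (hle _ _ _ hb hp₂ hp2 ⟨hx.1.le, hx.2⟩) (by positivity) (by linarith)
  · exact intervalIntegrable_const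
  · filter_upwards [hne1] with x hx1 hx
    rw [Set.uIoc_of_le zero_le_one] at hx
    have hlt : x < 1 := lt_of_le_of_ne hx.2 hx1
    refine Continuous.continuousWithinAt ?_
    exact (continuous_fst.rpow_const fun _ => Or.inr (by linarith)).mul
      (continuous_snd.rpow_const fun _ => Or.inr hx.1.le)

theorem isOperatorMean_logMean : IsOperatorMean logMean where
  nonneg s t hs ht := by
    rw [logMean_eq_integral hs ht]
    exact intervalIntegral.integral_nonneg zero_le_one fun x _ => by positivity
  continuousOn := continuousOn_logMean
  exists_monotone := by
    refine ⟨fun t => ∫ x in (0 : ℝ)..1, t ^ x, fun t ht => ?_, ?_, ?_, fun s t hs ht => ?_⟩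
    · refine intervalIntegral.intervalIntegral_pos_of_pos ?_ (fun x => by positivity) one_pos
      exact (Real.continuous_const_rpow ht.ne').intervalIntegrable 0 1
    · exact isOperatorMonotone_integral (f := fun x t => t ^ x)
        (fun x hx => isOperatorMonotone_rpow hx)
        fun t ht => (Real.continuous_const_rpow ht.ne').intervalIntegrable 0 1
    · simp
    · rw [logMean_eq_integral hs.le ht.le, ← intervalIntegral.integral_const_mul]
      congr 1
      ext x
      rw [Real.div_rpow ht.le hs.le, Real.rpow_sub hs, Real.rpow_one]
      ring

/-! ### The modified logarithmic Sobolev inequality -/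

theorem FirstOrderCalculus.normSqMean_one {n : ℕ}
    (C : FirstOrderCalculus.{u} (1 : Mat n) (depolarizing n)) {Λ : ℝ → ℝ → ℝ} (hΛ : Λ 1 1 = 1)
    (ξ : C.F) : C.normSqMean Λ 1 ξ = (tau (C.ip ξ ξ)).re := by
  have h : C.Vrho 1 (-Complex.I) ξ = ((1 : ℝ) : ℂ) • ξ := by
    rw [C.Vrho_neg_I, mpow_one_left, mpow_one_left]
    change ((1 : Mat n) •> ξ) <• (1 : Mat n) = _
    simp
  rw [normSqMean, innerMean, funCalc_apply_eigenvector _ _ _ _ h, hΛ, mul_one]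
  simp

/-- At `ρ = 1`, which the semigroup fixes, the norm is the one given by `τ`, and the estimate reads
`e^{-2t} N ≤ e^{-2Kt} N` with `N > 0`, as `A = e_ii` is not scalar. -/
theorem FirstOrderCalculus.le_one_of_gradientEstimate {n : ℕ} (hn : 2 ≤ n)
    (C : FirstOrderCalculus.{u} (1 : Mat n) (depolarizing n)) {Λ : ℝ → ℝ → ℝ} (hΛ : Λ 1 1 = 1)
    {K : ℝ} (hK : C.GradientEstimate Λ K) : K ≤ 1 := by
  have hn1 : 1 ≤ n := by omega
  let i : Fin n := ⟨0, by omega⟩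
  have hA : (Matrix.single i i 1 : Mat n).IsHermitian := by
    rw [Matrix.IsHermitian, Matrix.conjTranspose_single, star_one]
  have h := hK _ 1 hA Matrix.PosDef.one 1 zero_le_one
  have hP1 : depolarizing n 1 (1 : Mat n) = 1 :=
    (isGNSSymmetricQMS_depolarizing hn1).qms.unital 1 zero_le_one
  rw [dagger_depolarizing, hP1, C.d_depolarizing, C.normSqMean_smul, C.normSqMean_one hΛ] at h
  have hpos : 0 < (tau (C.ip (C.d (Matrix.single i i 1)) (C.d (Matrix.single i i 1)))).re := by
    have hτ : tau (Matrix.single i i 1 : Mat n) = (((n : ℝ)⁻¹ : ℝ) : ℂ) := by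
      rw [tau, Matrix.trace_single_eq_same]; simp
    rw [C.tau_ip_d_d hn1, hA.eq, Matrix.single_mul_single_same, mul_one, hτ, Complex.star_def,
      Complex.conj_ofReal, ← Complex.ofReal_mul, ← Complex.ofReal_sub, Complex.ofReal_re]
    have h0 : (0 : ℝ) < (n : ℝ)⁻¹ := by positivity
    have h1 : (n : ℝ)⁻¹ < 1 := inv_lt_one_of_one_lt₀ (by exact_mod_cast (by omega : 1 < n))
    nlinarith
  have h2 := le_of_mul_le_mul_right h hpos
  rw [sq, ← Real.exp_add, Real.exp_le_exp] at h2
  linarith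

/-- The two sides of the modified logarithmic Sobolev inequality in terms of the eigenvalues. -/
theorem tau_entropy_conjDiag {n : ℕ} {U : Mat n} (hU : U ∈ Matrix.unitaryGroup (Fin n) ℂ)
    (l : Fin n → ℝ) (hτ : tau (conjDiag U l) = 1) :
    (tau (conjDiag U l * cfc Real.log (conjDiag U l))).re =
        (n : ℝ)⁻¹ * ∑ i, l i * Real.log (l i) ∧
      (tau (generator (depolarizing n) (conjDiag U l) * cfc Real.log (conjDiag U l))).re =
        (n : ℝ)⁻¹ * ∑ i, (l i - 1) * Real.log (l i) := by
  have hgen : generator (depolarizing n) (conjDiag U l) = conjDiag U (fun i => l i + -1) := by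
    rw [generator_depolarizing, hτ, conjDiag_add, conjDiag_const hU]
    simp [sub_eq_add_neg]
  have hre : ∀ r : ℝ, ((n : ℂ)⁻¹ * (r : ℂ)).re = (n : ℝ)⁻¹ * r := by
    intro r
    rw [← Complex.ofReal_natCast, ← Complex.ofReal_inv, Complex.re_ofReal_mul, Complex.ofReal_re]
  rw [hgen, cfc_conjDiag hU, conjDiag_mul hU, conjDiag_mul hU, tau, tau, trace_conjDiag hU,
    trace_conjDiag hU, hre, hre]
  exact ⟨rfl, rfl⟩

theorem entropy_nonneg_of_sum_eq {n : ℕ} {l : Fin n → ℝ} (hl : ∀ i, 0 < l i)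
    (hs : ∑ i, l i = n) : 0 ≤ ∑ i, l i * Real.log (l i) := by
  have h : ∑ i, (l i - 1) ≤ ∑ i, l i * Real.log (l i) := by
    refine Finset.sum_le_sum fun i _ => ?_
    have := mul_le_mul_of_nonneg_left (Real.one_sub_inv_le_log_of_pos (hl i)) (hl i).le
    rwa [mul_sub, mul_one, mul_inv_cancel₀ (hl i).ne'] at this
  simpa [hs] using h

/-- Termwise comparison of `∑ x^(2k+2)/(2k+1)` with `∑ x^(2k+2)/(k+1)`. For eigenvalues `1 ± x` this
is exactly the Sobolev inequality with constant `2`. -/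
theorem half_mul_log_sub_log_le {x : ℝ} (hx : |x| < 1) :
    x / 2 * (Real.log (1 + x) - Real.log (1 - x)) ≤ -Real.log (1 - x ^ 2) := by
  have h1 := (Real.hasSum_log_sub_log_of_abs_lt_one hx).mul_left (x / 2)
  have hx2 : |x ^ 2| < 1 := by rw [abs_pow]; exact pow_lt_one₀ (abs_nonneg x) hx two_ne_zero
  have h2 := Real.hasSum_pow_div_log_of_abs_lt_one hx2
  refine hasSum_le (fun k => ?_) h1 h2
  have e : x / 2 * (2 * (1 / (2 * (k : ℝ) + 1)) * x ^ (2 * k + 1)) =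
      (x ^ 2) ^ (k + 1) / (2 * k + 1) := by
    rw [← pow_mul]
    ring
  rw [e]
  refine div_le_div_of_nonneg_left (by positivity) (by positivity) ?_
  have : (0 : ℝ) ≤ k := k.cast_nonneg
  linarith

theorem two_mul_le_log_sub_log {x : ℝ} (hx0 : 0 ≤ x) (hx : x < 1) :
    2 * x ≤ Real.log (1 + x) - Real.log (1 - x) := by
  have h1 := Real.hasSum_log_sub_log_of_abs_lt_one (by rwa [abs_of_nonneg hx0])
  have := le_hasSum h1 0 fun k _ => by positivity
  simpa using this

theorem hasMLSI_two : HasMLSI (depolarizing 2) 2 := by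
  intro ρ hρ hτ
  obtain ⟨U, hU, l, hl, rfl⟩ := exists_eq_conjDiag_of_posDef hρ
  obtain ⟨h1, h2⟩ := tau_entropy_conjDiag hU l hτ
  rw [h1, h2, Fin.sum_univ_two, Fin.sum_univ_two]
  have hsum : l 0 + l 1 = 2 := by
    rw [tau, trace_conjDiag hU, Fin.sum_univ_two] at hτ
    have : ((l 0 + l 1 : ℝ) : ℂ) = ((2 : ℝ) : ℂ) := by
      push_cast at hτ ⊢
      linear_combination 2 * hτ
    exact_mod_cast this
  obtain ⟨x, hx⟩ : ∃ x, x = l 0 - 1 := ⟨_, rfl⟩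
  have e0 : l 0 = 1 + x := by linarith
  have e1 : l 1 = 1 - x := by linarith
  have p0 := hl 0
  have p1 := hl 1
  rw [e0] at p0
  rw [e1] at p1
  have habs : |x| < 1 := abs_lt.mpr ⟨by linarith, by linarith⟩
  have key := half_mul_log_sub_log_le habs
  have hlog : Real.log (1 - x ^ 2) = Real.log (1 + x) + Real.log (1 - x) := by
    rw [← Real.log_mul p0.ne' p1.ne']; congr 1; ring
  rw [hlog] at key
  rw [e0, e1]
  push_cast
  nlinarith

/-- For eigenvalues `1 ± x` and `y = x²`, the inequality together with first-order bounds on the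
logarithms gives `2(1-y)(α-1) ≤ α`, which tends to `α ≤ 2` as `y → 0`. -/
theorem le_two_of_hasMLSI {α : ℝ} (hα : HasMLSI (depolarizing 2) α) : α ≤ 2 := by
  by_contra hlt
  push Not at hlt
  -- The final bound amounts to `α − 2 ≤ 2(α−1)y`; this `y` makes the right side `(α−2)/2`, a
  -- contradiction.
  set y : ℝ := (α - 2) / (4 * (α - 1)) with hy
  have hα1 : 0 < α - 1 := by linarith
  have hy0 : 0 < y := div_pos (by linarith) (by linarith)
  have hy1 : y < 1 := by rw [hy, div_lt_one (by linarith)]; linarith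
  have hymul : 4 * (α - 1) * y = α - 2 := by rw [hy]; field_simp
  set x := Real.sqrt y with hx
  have hxy : x ^ 2 = y := Real.sq_sqrt hy0.le
  have hx0 : 0 < x := Real.sqrt_pos.mpr hy0
  have hx1 : x < 1 := by nlinarith
  have hone : (1 : Mat 2) ∈ Matrix.unitaryGroup (Fin 2) ℂ := one_mem _
  have hl : ∀ i : Fin 2, 0 < ![1 + x, 1 - x] i := by
    intro i
    fin_cases i
    · simp; linarith
    · simp; linarith
  have hτ : tau (conjDiag (1 : Mat 2) ![1 + x, 1 - x]) = 1 := by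
    rw [tau, trace_conjDiag hone, Fin.sum_univ_two]
    simp; norm_num
  have h := hα _ (conjDiag_posDef hone hl) hτ
  obtain ⟨h1, h2⟩ := tau_entropy_conjDiag hone _ hτ
  rw [h1, h2, Fin.sum_univ_two, Fin.sum_univ_two] at h
  simp only [Matrix.cons_val_zero, Matrix.cons_val_one] at h
  have hD := two_mul_le_log_sub_log hx0.le hx1
  have hlog : Real.log (1 - y) = Real.log (1 + x) + Real.log (1 - x) := by
    rw [← Real.log_mul (by linarith) (by linarith), ← hxy]; congr 1; ring
  have hS := Real.one_sub_inv_le_log_of_pos (show 0 < 1 - y by linarith)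
  have hS' : -(y) ≤ (1 - y) * Real.log (1 - y) := by
    have := mul_le_mul_of_nonneg_left hS (show 0 ≤ 1 - y by linarith)
    rw [mul_sub, mul_one, mul_inv_cancel₀ (by linarith)] at this
    linarith
  set D := Real.log (1 + x) - Real.log (1 - x) with hDdef
  have hmain : (α - 1) * (x * D) ≤ -α * Real.log (1 - y) := by
    rw [hlog, hDdef]
    push_cast at h
    linarith
  have hxD : 2 * y ≤ x * D := by nlinarith
  have h3 : (α - 1) * (2 * y) ≤ -α * Real.log (1 - y) :=
    (mul_le_mul_of_nonneg_left hxD hα1.le).trans hmain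
  have h4 : (1 - y) * ((α - 1) * (2 * y)) ≤ α * y := by
    have := mul_le_mul_of_nonneg_left h3 (show 0 ≤ 1 - y by linarith)
    nlinarith
  have h5 : (1 - y) * ((α - 1) * 2) ≤ α := by
    refine le_of_mul_le_mul_right ?_ hy0
    linarith
  linarith

theorem HasMLSI.mono {n : ℕ} (hn : 1 ≤ n) {α β : ℝ} (hβ : HasMLSI (depolarizing n) β)
    (h : α ≤ β) : HasMLSI (depolarizing n) α := by
  intro ρ hρ hτ
  refine le_trans (mul_le_mul_of_nonneg_right h ?_) (hβ ρ hρ hτ)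
  obtain ⟨U, hU, l, hl, rfl⟩ := exists_eq_conjDiag_of_posDef hρ
  rw [(tau_entropy_conjDiag hU l hτ).1]
  refine mul_nonneg (by positivity) (entropy_nonneg_of_sum_eq hl ?_)
  have hn0 : (n : ℂ) ≠ 0 := by exact_mod_cast (by omega : n ≠ 0)
  rw [tau, trace_conjDiag hU, inv_mul_eq_one₀ hn0] at hτ
  exact_mod_cast hτ.symm

end QMS

end

/-! ### Assembly of the theorem. -/

theorem mainTheorem3 (n : ℕ) (hn : 1 ≤ n) :
    IsGNSSymmetricQMS (1 : Mat n) (depolarizing n) ∧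
    Nonempty (FirstOrderCalculus.{0} (1 : Mat n) (depolarizing n)) ∧
    (∀ (C : FirstOrderCalculus.{u} (1 : Mat n) (depolarizing n)) (Λ : ℝ → ℝ → ℝ),
      IsOperatorMean Λ → C.GradientEstimate Λ (1 / 2 + 1 / (n : ℝ))) ∧
    (2 ≤ n →
      (1 / 2 + 1 / ((n : ℝ) + 1) < 1 / 2 + 1 / (n : ℝ)) ∧
      ∀ C : FirstOrderCalculus.{u} (1 : Mat n) (depolarizing n),
        IsGreatest {K : ℝ | C.IntertwiningCurvatureGE K} (1 / 2 + 1 / ((n : ℝ) + 1))) ∧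
    (n = 2 →
      IsOperatorMean logMean ∧
      (∀ (C : FirstOrderCalculus.{u} (1 : Mat n) (depolarizing n)) (K : ℝ),
        C.GradientEstimate logMean K → HasMLSI (depolarizing n) (2 * K)) ∧
      IsGreatest {α : ℝ | HasMLSI (depolarizing n) α} 2) := by
  refine ⟨isGNSSymmetricQMS_depolarizing hn, ⟨commutatorCalculus hn⟩,
    fun C Λ hΛ => C.gradientEstimate hΛ, fun hn2 => ⟨?_, fun C => ⟨?_, ?_⟩⟩, ?_⟩
  · have hn0 : (0 : ℝ) < n := by positivity
    have := one_div_lt_one_div_of_lt hn0 (lt_add_one (n : ℝ))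
    linarith
  · exact C.intertwiningCurvatureGE hn
  · exact fun K hK => C.le_of_intertwiningCurvatureGE hn2 hK
  · rintro rfl
    refine ⟨isOperatorMean_logMean, fun C K hK => ?_, hasMLSI_two, fun α hα => le_two_of_hasMLSI hα⟩
    -- No gradient-flow argument is needed: `2K ≤ 2`, and the inequality with constant `2` is
    -- already known.
    have hK1 := C.le_one_of_gradientEstimate le_rfl (isOperatorMean_logMean.self one_pos) hK
    exact hasMLSI_two.mono hn (by linarith)
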